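/- Let $H$ be a separable real Hilbert space and let $A$ be a selfadjoint strictly positive linear operator on $H$ with dense domain $\mathcal D(A)$ and compact inverse. Let $V=\mathcal D(A^{1/2})$ with norm $\|u\|_V=\|A^{1/2}u\|_H$. Let $\ell\in(0,\infty]$, $\Omega=(0,\ell)$, and let $\mu:\Omega\to(0,\infty)$ be nonincreasing, summable, absolutely continuous on every compact interval contained in $\Omega$, and such that $\mu(s)\to0$ as $s\to\ell$. Put $\nu=1/\mu$ and let $$\mathcal V=L^2_\nu(\Omega;V),\qquad \|\xi\|_{\mathcal V}^2=\int_0^\ell\nu(\tau)\|\xi(\tau)\|_V^2\,d\tau ,$$ $$\mathfrak A=V\times H\times\mathcal V,\qquad \|(u,v,\xi)\|_{\mathfrak A}^2=\|u\|_V^2+\|v\|_H^2+\|\xi\|_{\mathcal V}^2 .$$ Let $P\xi=D\xi$ (distributional derivative) with domain $\mathcal D(P)=\{\xi\in\mathcal V: D\xi\in\mathcal V,\ \xi(\ell)=0\}$, where $\xi(\ell)=\lim_{\tau\to\ell}\xi(\tau)$ in $V$, and let $$\mathbb A(u,v,\xi)=\Big(v,\,-A\Big[u+\int_0^\ell\xi(\tau)\,d\tau\Big],\,P\xi+\mu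 v\Big),$$ $$\mathcal D(\mathbb A)=\Big\{(u,v,\xi)\in\mathfrak A:\ v\in V,\ u+\int_0^\ell\xi(\tau)\,d\tau\in\mathcal D(A),\ \xi\in\mathcal D(P)\Big\}.$$ Theorem 9.1. Assume that, for some $\delta>0$, $\mu'(s)+\delta\mu(s)\le0$ for almost every $s\in\Omega$. Then $\mathbb A$ is the infinitesimal generator of a strongly continuous semigroup $S(t)$ of bounded linear operators on $\mathfrak A$, and this semigroup is exponentially stable: there exist $K>1$ and $\omega>0$ such that $$\|S(t)z\|_{\mathfrak A}\le K\,\|z\|_{\mathfrak A}\,e^{-\omega t}$$ for every $t\ge0$ and every $z\in\mathfrak A$. -/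

import Mathlib

open MeasureTheory Filter Topology Set
open scoped NNReal ENNReal RealInnerProductSpace

noncomputable section

namespace MemoryState

universe u

/-! ### The operator `A` -/

/-- A selfadjoint strictly positive (densely defined, unbounded) operator with compact inverse on a
real Hilbert space. -/
structure PosOperator (H : Type u) [NormedAddCommGroup H] [InnerProductSpace ℝ H]
    [CompleteSpace H] where
  /-- the operator, with its domain -/
  op : H →ₗ.[ℝ] H
  dense_domain : Dense (op.domain : Set H)
  selfAdjoint : IsSelfAdjoint op
  pos : ∀ x : op.domain, (x : H) ≠ 0 → 0 < ⟪op x, (x : H)⟫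
  /-- `A` is a bijection of its domain onto `H`, and its inverse is a compact operator. -/
  compact_inverse : ∃ B : H →L[ℝ] H, IsCompactOperator B ∧
    (∀ y : H, (B y, y) ∈ op.graph) ∧ ∀ x : op.domain, B (op x) = x

namespace PosOperator

variable {H : Type u} [NormedAddCommGroup H] [InnerProductSpace ℝ H] [CompleteSpace H]
  (A : PosOperator H)

/-- The eigenspace `{x ∈ D(A) : A x = c x}`. -/
def eigenspace (c : ℝ) : Submodule ℝ H :=
  A.op.graph.comap (LinearMap.prod LinearMap.id (c • LinearMap.id))

lemma mem_eigenspace {c : ℝ} {x : H} : x ∈ A.eigenspace c ↔ (x, c • x) ∈ A.op.graph := by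
  simp [eigenspace]

lemma isClosed_eigenspace (c : ℝ) : IsClosed (A.eigenspace c : Set H) := by
  have h : IsClosed (A.op.graph : Set (H × H)) := A.selfAdjoint.isClosed
  have hc : Continuous fun x : H => (x, c • x) := by fun_prop
  have := h.preimage hc
  convert this using 1
  ext x
  exact A.mem_eigenspace

instance (c : ℝ) : CompleteSpace (A.eigenspace c) :=
  (A.isClosed_eigenspace c).completeSpace_coe

/-- The orthogonal projection of `H` onto the eigenspace of `A` at `c` (zero if `c` is not an
eigenvalue). -/
def eigenproj (c : ℝ) : H →L[ℝ] H := (A.eigenspace c).starProjection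

/-- The square root `A^{1/2}`, by the spectral theorem: since `A` has compact inverse,
`A = ∑ c P_c` over its eigenvalues `c > 0`, with `P_c` the eigenprojections, so that
`A^{1/2} x = ∑ √c P_c x`, with domain the set of those `x` for which the series converges in `H`. -/
def sqrt : H →ₗ.[ℝ] H where
  domain :=
    { carrier := {x | Summable fun c : ℝ => √c • A.eigenproj c x}
      add_mem' := fun {x y} hx hy => by
        have := Summable.add hx hy
        simpa only [Set.mem_ofPred_eq, map_add, smul_add] using this
      zero_mem' := by simp
      smul_mem' := fun r x hx => by
        have := Summable.const_smul r hx
        simpa only [Set.mem_ofPred_eq, map_smul, smul_comm r] using this }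
  toFun :=
    { toFun := fun x => ∑' c : ℝ, √c • A.eigenproj c (x : H)
      map_add' := fun x y => by
        have := Summable.tsum_add x.2 y.2
        simpa only [Submodule.coe_add, map_add, smul_add] using this
      map_smul' := fun r x => by
        have := Summable.tsum_const_smul r x.2
        simpa only [Submodule.coe_smul, map_smul, smul_comm r, RingHom.id_apply] using this }

lemma symm_graph {x x' y y' : H} (hx : (x, x') ∈ A.op.graph) (hy : (y, y') ∈ A.op.graph) :
    ⟪x', y⟫ = ⟪x, y'⟫ := by
  obtain ⟨a, rfl, rfl⟩ := A.op.mem_graph_iff.1 hx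
  obtain ⟨b, rfl, rfl⟩ := A.op.mem_graph_iff.1 hy
  have h := LinearPMap.adjoint_isFormalAdjoint A.dense_domain (T := A.op)
  rw [LinearPMap.isSelfAdjoint_def.1 A.selfAdjoint] at h
  exact h a b

lemma eigenspace_orthogonal {c d : ℝ} (h : c ≠ d) {x y : H} (hx : x ∈ A.eigenspace c)
    (hy : y ∈ A.eigenspace d) : ⟪x, y⟫ = 0 := by
  have := A.symm_graph (A.mem_eigenspace.1 hx) (A.mem_eigenspace.1 hy)
  rw [real_inner_smul_left, real_inner_smul_right] at this
  have h2 : (c - d) * ⟪x, y⟫ = 0 := by linarith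
  exact (mul_eq_zero.1 h2).resolve_left (sub_ne_zero.2 h)

lemma eigenspace_nonpos {c : ℝ} (hc : c ≤ 0) {x : H} (hx : x ∈ A.eigenspace c) : x = 0 := by
  by_contra hne
  obtain ⟨a, ha, ha'⟩ := A.op.mem_graph_iff.1 (A.mem_eigenspace.1 hx)
  simp only at ha ha'
  have := A.pos a (by rw [ha]; exact hne)
  rw [ha', ha, real_inner_smul_left] at this
  nlinarith [real_inner_self_nonneg (x := x)]

/-- The eigenspaces of `A` span a dense subspace of `H`. -/
lemma eq_zero_of_eigenproj {x : H} (h : ∀ c, A.eigenproj c x = 0) : x = 0 := by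
  obtain ⟨B, hB, hgr, -⟩ := A.compact_inverse
  have hsym : (B : H →ₗ[ℝ] H).IsSymmetric := fun y z =>
    (A.symm_graph (hgr y) (hgr z)).symm
  have hort := ContinuousLinearMap.orthogonalComplement_iSup_eigenspaces_eq_bot hB hsym
  rw [← Submodule.mem_bot ℝ, ← hort, Submodule.mem_orthogonal]
  intro y hy
  suffices hle : (⨆ m, Module.End.eigenspace (B : H →ₗ[ℝ] H) m) ≤ (ℝ ∙ x)ᗮ by
    have := (Submodule.mem_orthogonal_singleton_iff_inner_right).1 (hle hy)
    rw [real_inner_comm]; exact this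
  refine iSup_le fun m y hy => ?_
  rw [Submodule.mem_orthogonal_singleton_iff_inner_right]
  have hBy : B y = m • y := Module.End.mem_eigenspace_iff.1 hy
  have hg := hgr y
  rw [hBy] at hg
  rcases eq_or_ne m 0 with rfl | hm
  · have hy0 : y = 0 := A.op.graph_fst_eq_zero_snd hg (by simp)
    simp [hy0]
  · have hyE : y ∈ A.eigenspace m⁻¹ := by
      rw [A.mem_eigenspace]
      have := A.op.graph.smul_mem m⁻¹ hg
      simpa [smul_smul, inv_mul_cancel₀ hm] using this
    have h1 := (A.eigenspace m⁻¹).starProjection_inner_eq_zero x y hyE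
    have h2 : (A.eigenspace m⁻¹).starProjection x = 0 := h m⁻¹
    simpa [h2] using h1

lemma sqrt_injective : Function.Injective A.sqrt.toFun := by
  rw [injective_iff_map_eq_zero]
  intro x hx
  apply Subtype.ext
  apply A.eq_zero_of_eigenproj
  intro c
  rcases le_or_gt c 0 with hc | hc
  · exact A.eigenspace_nonpos hc ((A.eigenspace c).starProjection_apply_mem (x : H))
  have hs : HasSum (fun d : ℝ => √d • A.eigenproj d (x : H)) 0 := by
    have h := (show Summable fun d : ℝ => √d • A.eigenproj d (x : H) from x.2).hasSum
    have hx' : ∑' d : ℝ, √d • A.eigenproj d (x : H) = 0 := hx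
    rwa [hx'] at h
  have h1 := (hs.mapL (innerSL ℝ (A.eigenproj c (x : H))))
  have h2 : HasSum (fun d : ℝ => innerSL ℝ (A.eigenproj c (x : H)) (√d • A.eigenproj d (x : H)))
      (innerSL ℝ (A.eigenproj c (x : H)) (√c • A.eigenproj c (x : H))) := by
    apply hasSum_single
    intro d hd
    simp only [innerSL_apply_apply, real_inner_smul_right]
    have h0 : ⟪A.eigenproj c (x : H), A.eigenproj d (x : H)⟫ = 0 :=
      A.eigenspace_orthogonal (Ne.symm hd) ((A.eigenspace c).starProjection_apply_mem (x : H))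
        ((A.eigenspace d).starProjection_apply_mem (x : H))
    rw [h0, mul_zero]
  have h3 := h2.unique h1
  simp only [innerSL_apply_apply, real_inner_smul_right, inner_zero_right, mul_eq_zero,
    inner_self_eq_zero] at h3
  exact h3.resolve_left (Real.sqrt_pos.2 hc).ne'

/-- The space `V = D(A^{1/2})`. Its norm is `‖u‖_V = ‖A^{1/2} u‖_H` (and not the norm of `H`). -/
def V : Type u := A.sqrt.domain

instance : AddCommGroup A.V := inferInstanceAs (AddCommGroup A.sqrt.domain)

instance : Module ℝ A.V := inferInstanceAs (Module ℝ A.sqrt.domain)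

/-- The inclusion of `V` in `H`. -/
def incl : A.V →ₗ[ℝ] H := A.sqrt.domain.subtype

/-- The map `A^{1/2} : V → H`. -/
def sqrtV : A.V →ₗ[ℝ] H := A.sqrt.toFun

instance : NormedAddCommGroup A.V := NormedAddCommGroup.induced A.V H A.sqrtV A.sqrt_injective

lemma norm_V (u : A.V) : ‖u‖ = ‖A.sqrtV u‖ := rfl

instance : InnerProductSpace ℝ A.V where
  norm_smul_le r u := by rw [norm_V, norm_V, map_smul, norm_smul]
  inner u w := ⟪A.sqrtV u, A.sqrtV w⟫
  norm_sq_eq_re_inner u := by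
    rw [norm_V, ← real_inner_self_eq_norm_sq]; rfl
  conj_inner_symm u w := by
    simp only [conj_trivial]; exact real_inner_comm _ _
  add_left u v w := by rw [map_add, inner_add_left]
  smul_left u w r := by rw [map_smul, real_inner_smul_left]; rfl

end PosOperator

/-! ### The memory kernel -/

/-- The interval `Ω = (0, ℓ)`, `ℓ ∈ (0, ∞]`. -/
def interval (ℓ : EReal) : Set ℝ := {s | 0 < s ∧ (s : EReal) < ℓ}

/-- The filter `s → ℓ`, `s < ℓ` on the real line (`s → ∞` if `ℓ = ∞`). -/
def leftOf (ℓ : EReal) : Filter ℝ := comap ((↑) : ℝ → EReal) (𝓝[<] ℓ)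

/-- A memory kernel `μ : Ω = (0, ℓ) → (0, ∞)`: nonincreasing, summable, absolutely continuous on
the compact subintervals of `Ω`, with `μ(s) → 0` as `s → ℓ`. Only the values on `Ω` matter.
The elastic modulus `α` of the equation with memory is normalised by `α = 1 + ∫ μ`, and does not
enter otherwise. -/
structure Kernel where
  /-- the length of the delay -/
  ℓ : EReal
  ℓ_pos : 0 < ℓ
  /-- the kernel -/
  μ : ℝ → ℝ
  pos : ∀ s ∈ interval ℓ, 0 < μ s
  antitoneOn : AntitoneOn μ (interval ℓ)
  integrableOn : IntegrableOn μ (interval ℓ)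
  absCont : ∀ a b : ℝ, a ≤ b → Icc a b ⊆ interval ℓ → AbsolutelyContinuousOnInterval μ a b
  tendsto_zero : Tendsto μ (leftOf ℓ) (𝓝 0)

namespace Kernel

/-- The domain `Ω = (0, ℓ)` of the kernel. -/
def Ω (κ : Kernel) : Set ℝ := interval κ.ℓ

/-- The weight `ν = 1 / μ`. -/
def ν (κ : Kernel) (s : ℝ) : ℝ := 1 / κ.μ s

/-- The measure `ν(τ) dτ` on `Ω`. -/
def νMeasure (κ : Kernel) : Measure ℝ :=
  (volume.restrict κ.Ω).withDensity fun s => ENNReal.ofReal (κ.ν s)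

end Kernel

/-! ### The state space and the operator `P` -/

variable {H : Type u} [NormedAddCommGroup H] [InnerProductSpace ℝ H] [CompleteSpace H]

/-- The state space `𝒱 = L²_ν(Ω; V)`, with `‖ξ‖² = ∫_Ω ν(τ) ‖ξ(τ)‖_V² dτ`. -/
abbrev StateSpace (A : PosOperator H) (κ : Kernel) : Type u := Lp A.V 2 κ.νMeasure

/-- `g` is the distributional derivative of `f` on `Ω`. -/
def IsWeakDeriv {X : Type*} [NormedAddCommGroup X] [NormedSpace ℝ X] (Ω : Set ℝ)
    (f g : ℝ → X) : Prop :=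
  ∀ φ : ℝ → ℝ, ContDiff ℝ (⊤ : ℕ∞) φ → HasCompactSupport φ → tsupport φ ⊆ Ω →
    ∫ τ in Ω, deriv φ τ • f τ = -∫ τ in Ω, φ τ • g τ

/-- `ξ(ℓ) = lim_{τ → ℓ} ξ(τ) = 0` in `X`, for the continuous representative of `ξ` on `Ω`. -/
def VanishesAtEnd {X : Type*} [NormedAddCommGroup X] (ℓ : EReal) (ξ : ℝ → X) : Prop :=
  ∃ f : ℝ → X, ContinuousOn f (interval ℓ) ∧ ξ =ᵐ[volume.restrict (interval ℓ)] f ∧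
    Tendsto f (leftOf ℓ) (𝓝 0)

/-- The graph of the operator `P ξ = Dξ` with domain `D(P) = {ξ ∈ 𝒱 : Dξ ∈ 𝒱, ξ(ℓ) = 0}`:
`ξ ∈ D(P)` and `P ξ = η`. -/
def PGraph (A : PosOperator H) (κ : Kernel) (ξ η : StateSpace A κ) : Prop :=
  IsWeakDeriv κ.Ω (ξ : ℝ → A.V) η ∧ VanishesAtEnd κ.ℓ (ξ : ℝ → A.V)

/-! ### The extended state space and the operator `𝔸` -/

/-- The extended state space `𝔄 = V × H × 𝒱`, with
`‖(u, v, ξ)‖² = ‖u‖_V² + ‖v‖_H² + ‖ξ‖_𝒱²`. -/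
abbrev ExtState (A : PosOperator H) (κ : Kernel) : Type u :=
  WithLp 2 (A.V × WithLp 2 (H × StateSpace A κ))

namespace ExtState

variable {A : PosOperator H} {κ : Kernel}

/-- The first component `u ∈ V`. -/
def u (z : ExtState A κ) : A.V := z.fst

/-- The second component `v ∈ H`. -/
def v (z : ExtState A κ) : H := z.snd.fst

/-- The third component `ξ ∈ 𝒱`. -/
def ξ (z : ExtState A κ) : StateSpace A κ := z.snd.snd

end ExtState

/-- The graph of the operator `𝔸(u, v, ξ) = (v, -A[u + ∫_Ω ξ], P ξ + μ v)` with domain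
`D(𝔸) = {(u, v, ξ) : v ∈ V, u + ∫_Ω ξ ∈ D(A), ξ ∈ D(P)}`: `z ∈ D(𝔸)` and `𝔸 z = z'`. -/
def AAGraph (A : PosOperator H) (κ : Kernel) (z z' : ExtState A κ) : Prop :=
  A.incl z'.u = z.v ∧
  (A.incl (z.u + ∫ τ in κ.Ω, z.ξ τ), -z'.v) ∈ A.op.graph ∧
  ∃ η : StateSpace A κ, PGraph A κ z.ξ η ∧
    ∀ᵐ τ ∂volume.restrict κ.Ω, z'.ξ τ = η τ + κ.μ τ • z'.u

/-! ### Semigroups -/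

/-- Strongly continuous semigroups of bounded linear operators. -/
structure IsC0Semigroup {X : Type*} [NormedAddCommGroup X] [NormedSpace ℝ X]
    (S : ℝ≥0 → X →L[ℝ] X) : Prop where
  zero : S 0 = ContinuousLinearMap.id ℝ X
  add : ∀ s t, S (s + t) = (S s).comp (S t)
  continuous : ∀ x, Continuous fun t => S t x

/-- `S` is a strongly continuous semigroup whose infinitesimal generator has graph `G`: the limit
of `(S(h) x - x) / h` as `h → 0+` exists and equals `y` exactly when `G x y`. -/
structure IsGeneratedBy {X : Type*} [NormedAddCommGroup X] [NormedSpace ℝ X]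
    (S : ℝ≥0 → X →L[ℝ] X) (G : X → X → Prop) : Prop extends IsC0Semigroup S where
  generator : ∀ x y, G x y ↔
    Tendsto (fun h : ℝ≥0 => (h : ℝ)⁻¹ • (S h x - x)) (𝓝[>] 0) (𝓝 y)

end MemoryState

end

noncomputable section

namespace MemoryState

universe u

section

/-! ### The Lumer–Phillips theorem in Hilbert space -/

/-! The operator `𝔸` is m-dissipative for the energy norm, so Lumer–Phillips gives a contraction
semigroup; a perturbation of the energy by small cross terms is a strict Lyapunov functional, which
gives the decay.

Dissipativity rests on a cancellation. The elastic term and the coupling `μ v` contribute opposite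
amounts, because `x ↦ μ x` is the adjoint of `ξ ↦ ∫ ξ` in the weight `ν = 1/μ`. What remains is `⟪ξ,
Pξ⟫`. It is not integrated by parts: the solution of `l ξ - Dξ = k`, `ξ(ℓ) = 0` is an explicit
exponential convolution, a Schur-type estimate using `e^{δ(t-s)} ν(s) ≤ ν(t)` gives `‖ξ‖ ≤ (l +
δ/2)⁻¹ ‖k‖` (`eLpNorm_expConv_le`), and letting `l → ∞` yields `⟪ξ, Pξ⟫ ≤ -(δ/2) ‖ξ‖²`
(`PGraph.inner_le`). For the range condition, the resolvent equation of `𝔸` reduces to an equation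
`(A + a) w = f` with `a ≥ 0` (`exists_AAGraph_resolvent`).

The energy controls only the decay of `ξ`. To reach `v`, one uses the weighted integral `W ξ = ∫ (1
- e^{-s}) ξ`: the weight vanishes at `0`, so `W (Pξ) = W ξ - ∫ ξ` has no boundary term, while `W (μ
v) = c v` with `c > 0`. Hence `-⟪v, W ξ⟫` produces `-c ‖v‖²`, and `(c/2) ⟪v, u⟫` produces `-(c/2)
‖u‖²` at the cost of half of that. The errors all contain `ξ` and are absorbed by a large multiple
`N` of the energy (`AAGraph.lyapunov_le`, `IsGeneratedBy.norm_le_of_lyapunov`). -/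

/-- The graph of an `m`-dissipative operator on a real Hilbert space. -/
structure IsMDissipative {X : Type*} [NormedAddCommGroup X] [InnerProductSpace ℝ X]
    (G : Submodule ℝ (X × X)) : Prop where
  dissipative : ∀ x y, (x, y) ∈ G → ⟪x, y⟫ ≤ 0
  range : ∀ l : ℝ, 0 < l → ∀ f, ∃ x y, (x, y) ∈ G ∧ l • x - y = f
  single : ∀ y, ((0 : X), y) ∈ G → y = 0

section LumerPhillips

variable {X : Type*} [NormedAddCommGroup X] [InnerProductSpace ℝ X]

section Bounded

variable [CompleteSpace X]

lemma hasDerivAt_exp_smul_apply (P : X →L[ℝ] X) (x : X) (t : ℝ) :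
    HasDerivAt (fun s : ℝ => NormedSpace.exp (s • P) x) (NormedSpace.exp (t • P) (P x)) t := by
  have h := (hasDerivAt_exp_smul_const P t).clm_apply (hasDerivAt_const t x)
  simpa using h

lemma hasDerivAt_exp_smul_apply' (P : X →L[ℝ] X) (x : X) (t : ℝ) :
    HasDerivAt (fun s : ℝ => NormedSpace.exp (s • P) x) (P (NormedSpace.exp (t • P) x)) t := by
  have h := (hasDerivAt_exp_smul_const' P t).clm_apply (hasDerivAt_const t x)
  simpa using h

lemma exp_add_smul_apply (P : X →L[ℝ] X) (s t : ℝ) (x : X) :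
    NormedSpace.exp ((s + t) • P) x = NormedSpace.exp (s • P) (NormedSpace.exp (t • P) x) := by
  let _ := NormedAlgebra.restrictScalars ℚ ℝ (X →L[ℝ] X)
  rw [add_smul, NormedSpace.exp_add_of_commute]
  · rfl
  · exact ((Commute.refl P).smul_left s).smul_right t

/-- The exponential of a bounded dissipative operator is a contraction. -/
lemma norm_exp_smul_apply_le {P : X →L[ℝ] X} (hP : ∀ x, ⟪x, P x⟫ ≤ 0) {t : ℝ} (ht : 0 ≤ t)
    (x : X) : ‖NormedSpace.exp (t • P) x‖ ≤ ‖x‖ := by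
  have hd : ∀ s : ℝ, HasDerivAt (fun s : ℝ => ‖NormedSpace.exp (s • P) x‖ ^ 2)
      (2 * ⟪NormedSpace.exp (s • P) x, P (NormedSpace.exp (s • P) x)⟫) s :=
    fun s => (hasDerivAt_exp_smul_apply' P x s).norm_sq
  have ha : Antitone (fun s : ℝ => ‖NormedSpace.exp (s • P) x‖ ^ 2) :=
    antitone_of_hasDerivAt_nonpos hd fun s => by
      have := hP (NormedSpace.exp (s • P) x)
      simp only [Pi.zero_apply]
      linarith
  have h := ha ht
  simp only [zero_smul, NormedSpace.exp_zero, one_apply_eq_self] at h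
  exact le_of_sq_le_sq h (norm_nonneg _)

/-- Interpolate by `s ↦ e^{sP} e^{(t-s)Q} x`. Since `P` and `Q` commute, its derivative is two
contractions applied to `P x - Q x`. -/
lemma norm_exp_sub_exp_le {P Q : X →L[ℝ] X} (hP : ∀ x, ⟪x, P x⟫ ≤ 0) (hQ : ∀ x, ⟪x, Q x⟫ ≤ 0)
    (hPQ : Commute P Q) {t : ℝ} (ht : 0 ≤ t) (x : X) :
    ‖NormedSpace.exp (t • P) x - NormedSpace.exp (t • Q) x‖ ≤ t * ‖P x - Q x‖ := by
  have hd : ∀ s : ℝ, HasDerivAt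
      (fun s : ℝ => NormedSpace.exp (s • P) (NormedSpace.exp ((t - s) • Q) x))
      (NormedSpace.exp (s • P) (NormedSpace.exp ((t - s) • Q) (P x - Q x))) s := by
    intro s
    have h1 : HasDerivAt (fun s : ℝ => NormedSpace.exp ((t - s) • Q) x)
        (-(NormedSpace.exp ((t - s) • Q) (Q x))) s := by
      have h := (hasDerivAt_exp_smul_apply Q x (t - s)).scomp s ((hasDerivAt_id s).const_sub t)
      simpa [Function.comp_def] using h
    have h := (hasDerivAt_exp_smul_const P s).clm_apply h1
    have hc : Commute P (NormedSpace.exp ((t - s) • Q)) :=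
      Commute.exp_right (hPQ.smul_right (t - s))
    have hc' : P (NormedSpace.exp ((t - s) • Q) x) = NormedSpace.exp ((t - s) • Q) (P x) :=
      DFunLike.congr_fun hc.eq x
    convert! h using 1
    rw [map_sub, map_sub, ← hc']
    simp [sub_eq_add_neg]
  have h := norm_image_sub_le_of_norm_deriv_le_segment' (a := 0) (b := t) (C := ‖P x - Q x‖)
    (fun s _ => (hd s).hasDerivWithinAt) (fun s hs =>
      (norm_exp_smul_apply_le hP hs.1 _).trans
        (norm_exp_smul_apply_le hQ (sub_nonneg.2 hs.2.le) _)) t (right_mem_Icc.2 ht)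
  simpa [mul_comm] using h

end Bounded

variable {G : Submodule ℝ (X × X)}

namespace IsMDissipative

/-- Pairing `l x - y` with `x` and dropping `-⟪x, y⟫ ≥ 0` gives `l ‖x‖² ≤ ‖x‖ ‖l x - y‖`. -/
lemma norm_le (hG : IsMDissipative G) {l : ℝ} (hl : 0 < l) {x y : X} (h : (x, y) ∈ G) :
    ‖x‖ ≤ l⁻¹ * ‖l • x - y‖ := by
  have h1 : l * ‖x‖ ^ 2 ≤ ‖x‖ * ‖l • x - y‖ := by
    refine le_trans ?_ (real_inner_le_norm x (l • x - y))
    rw [inner_sub_right, real_inner_smul_right, real_inner_self_eq_norm_sq]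
    linarith [hG.dissipative x y h]
  rcases (norm_nonneg x).eq_or_lt with h0 | h0
  · rw [← h0]; positivity
  · rw [inv_mul_eq_div, le_div_iff₀ hl]
    nlinarith

lemma unique (hG : IsMDissipative G) {l : ℝ} (hl : 0 < l) {x y x' y' : X} (h : (x, y) ∈ G)
    (h' : (x', y') ∈ G) (he : l • x - y = l • x' - y') : x = x' := by
  have h1 := hG.norm_le hl (G.sub_mem h h')
  have h2 : l • (x - x') - (y - y') = 0 := by
    rw [smul_sub, sub_sub_sub_comm, he, sub_self]
  rw [h2, norm_zero, mul_zero] at h1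
  exact sub_eq_zero.1 (norm_le_zero_iff.1 h1)

/-- The resolvent `(l - 𝔸)⁻¹`. -/
lemma exists_resolvent (hG : IsMDissipative G) {l : ℝ} (hl : 0 < l) :
    ∃ R : X →L[ℝ] X, (∀ f, (R f, l • R f - f) ∈ G) ∧ (∀ x y, (x, y) ∈ G → R (l • x - y) = x) ∧
      ∀ f, ‖R f‖ ≤ l⁻¹ * ‖f‖ := by
  choose r s hrs hf using hG.range l hl
  have hr : ∀ f x y, (x, y) ∈ G → l • x - y = f → r f = x := fun f x y hxy he =>
    hG.unique hl (hrs f) hxy ((hf f).trans he.symm)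
  let R : X →ₗ[ℝ] X :=
    { toFun := r
      map_add' := fun f g => hr _ _ _ (G.add_mem (hrs f) (hrs g)) (by
        conv_rhs => rw [← hf f, ← hf g]
        simp only [smul_add]; abel)
      map_smul' := fun c f => hr _ _ _ (G.smul_mem c (hrs f)) (by
        conv_rhs => rw [← hf f]
        simp only [RingHom.id_apply, smul_sub, smul_comm l c]) }
  have hb : ∀ f, ‖R f‖ ≤ l⁻¹ * ‖f‖ := fun f => by
    have := hG.norm_le hl (hrs f)
    rwa [hf f] at this
  refine ⟨R.mkContinuous l⁻¹ hb, fun f => ?_, fun x y h => hr _ x y h rfl, hb⟩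
  have : l • r f - f = s f := by
    conv_lhs => rw [← hf f, hf f]
    rw [← sub_eq_zero]; nth_rw 2 [← hf f]; abel
  change (r f, l • r f - f) ∈ G
  rw [this]; exact hrs f

/-- The domain of an `m`-dissipative operator is dense. -/
lemma dense_domain [CompleteSpace X] (hG : IsMDissipative G) (x : X) {ε : ℝ} (hε : 0 < ε) :
    ∃ x' y', (x', y') ∈ G ∧ ‖x - x'‖ < ε := by
  have h : (G.map (LinearMap.fst ℝ X X)).topologicalClosure = ⊤ := by
    rw [Submodule.topologicalClosure_eq_top_iff, Submodule.eq_bot_iff]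
    intro z hz
    rw [Submodule.mem_orthogonal] at hz
    -- Write `z = a - b` with `(a, b)` in the graph. As `z ⟂ a`, `‖a‖² = ⟪a, b⟫ ≤ 0`, so `a = 0` and
    -- then `b = 0`.
    obtain ⟨a, b, hab, he⟩ := hG.range 1 one_pos z
    rw [one_smul] at he
    have h1 := hz a ⟨(a, b), hab, rfl⟩
    rw [← he, inner_sub_right, real_inner_self_eq_norm_sq] at h1
    have h2 := hG.dissipative a b hab
    have ha : a = 0 := by
      rw [← norm_eq_zero, ← sq_eq_zero_iff]
      nlinarith [sq_nonneg ‖a‖]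
    subst ha
    rw [← he, hG.single b hab, sub_zero]
  have hx : x ∈ closure ((G.map (LinearMap.fst ℝ X X) : Submodule ℝ X) : Set X) := by
    rw [← Submodule.topologicalClosure_coe, h]; trivial
  obtain ⟨x', ⟨p, hp, rfl⟩, hd⟩ := Metric.mem_closure_iff.1 hx ε hε
  exact ⟨p.1, p.2, hp, by rwa [dist_eq_norm] at hd⟩

/-- The Yosida approximations: bounded, dissipative and commuting, and convergent to `𝔸` on its
domain. -/
lemma exists_yosida [CompleteSpace X] (hG : IsMDissipative G) :
    ∃ Y : ℕ → X →L[ℝ] X, (∀ n x, ⟪x, Y n x⟫ ≤ 0) ∧ (∀ m n, Commute (Y m) (Y n)) ∧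
      ∀ x y, (x, y) ∈ G → Tendsto (fun n => Y n x) atTop (𝓝 y) := by
  have hl : ∀ n : ℕ, (0 : ℝ) < n + 1 := fun n => by positivity
  choose R hR hR' hb using fun n : ℕ => hG.exists_resolvent (hl n)
  have hres : ∀ m n : ℕ, ∀ f, R m f - R n f = ((n : ℝ) - m) • R m (R n f) := by
    intro m n f
    have h1 := hR' m _ _ (G.sub_mem (hR m f) (hR n f))
    have he : ((m : ℝ) + 1) • (R m f - R n f) -
        (((m : ℝ) + 1) • R m f - f - (((n : ℝ) + 1) • R n f - f)) = ((n : ℝ) - m) • R n f := by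
      module
    exact h1.symm.trans ((congrArg (R m) he).trans (map_smul _ _ _))
  have hcomm : ∀ m n : ℕ, Commute (R m) (R n) := by
    intro m n
    rcases eq_or_ne m n with rfl | hmn
    · exact Commute.refl _
    ext f
    change R m (R n f) = R n (R m f)
    have h1 := hres m n f
    have h2 := hres n m f
    have hne : (n : ℝ) - m ≠ 0 := sub_ne_zero.2 (by exact_mod_cast hmn.symm)
    have h3 : ((n : ℝ) - m) • (R m (R n f) - R n (R m f)) = 0 := by
      rw [smul_sub, ← h1, sub_eq_zero, ← neg_sub, h2, ← neg_smul, neg_sub]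
    exact sub_eq_zero.1 ((smul_eq_zero.1 h3).resolve_left hne)
  -- On the domain `l R y' - y' = R w` is `O(1/l)`; since `‖l R‖ ≤ 1`, density extends the limit to
  -- all `y`.
  have hlim : ∀ y, Tendsto (fun n : ℕ => ((n : ℝ) + 1) • R n y) atTop (𝓝 y) := by
    intro y
    rw [Metric.tendsto_atTop]
    intro ε hε
    obtain ⟨y', w, hw, hy'⟩ := hG.dense_domain y (ε := ε / 3) (by positivity)
    obtain ⟨N, hN⟩ := exists_nat_gt (‖w‖ / (ε / 3))
    refine ⟨N, fun n hn => ?_⟩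
    have h1 : ((n : ℝ) + 1) • R n y' - y' = R n w := by
      have := hR' n _ _ hw
      rw [map_sub, map_smul, sub_eq_iff_eq_add] at this
      rw [this]; abel
    have h2 : ‖R n w‖ < ε / 3 := by
      refine (hb n w).trans_lt ?_
      rw [inv_mul_eq_div, div_lt_iff₀ (hl n)]
      rw [div_lt_iff₀ (by positivity)] at hN
      have : (N : ℝ) ≤ n := by exact_mod_cast hn
      nlinarith
    have h3 : ‖((n : ℝ) + 1) • R n (y - y')‖ ≤ ‖y - y'‖ := by
      rw [norm_smul, Real.norm_of_nonneg (hl n).le]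
      calc _ ≤ ((n : ℝ) + 1) * (((n : ℝ) + 1)⁻¹ * ‖y - y'‖) :=
            mul_le_mul_of_nonneg_left (hb n _) (hl n).le
        _ = _ := by rw [mul_inv_cancel_left₀ (hl n).ne']
    have h4 : ((n : ℝ) + 1) • R n y - y = ((n : ℝ) + 1) • R n (y - y') + R n w - (y - y') := by
      rw [← h1, map_sub, smul_sub]; abel
    rw [dist_eq_norm, h4]
    calc _ ≤ ‖((n : ℝ) + 1) • R n (y - y') + R n w‖ + ‖y - y'‖ := norm_sub_le _ _
      _ ≤ ‖((n : ℝ) + 1) • R n (y - y')‖ + ‖R n w‖ + ‖y - y'‖ := by gcongr; exact norm_add_le _ _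
      _ < ε := by linarith
  -- `Y n = l (l R - 1)` with `l = n + 1`, the shift keeping `l > 0` at `n = 0`. On the domain it
  -- equals `l R y`, so `hlim` gives the convergence.
  let Y : ℕ → X →L[ℝ] X := fun n => ((n : ℝ) + 1) • (((n : ℝ) + 1) • R n - 1)
  have hY : ∀ n x, Y n x = ((n : ℝ) + 1) • (((n : ℝ) + 1) • R n x - x) := fun n x => rfl
  refine ⟨Y, fun n x => ?_, fun m n => ?_, fun x y h => ?_⟩
  · rw [hY, real_inner_smul_right, inner_sub_right, real_inner_smul_right,
      real_inner_self_eq_norm_sq]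
    refine mul_nonpos_of_nonneg_of_nonpos (hl n).le ?_
    have h1 : ⟪x, R n x⟫ ≤ ‖x‖ * (((n : ℝ) + 1)⁻¹ * ‖x‖) :=
      (real_inner_le_norm _ _).trans (by gcongr; exact hb n x)
    have h2 := mul_le_mul_of_nonneg_left h1 (hl n).le
    have h3 : ((n : ℝ) + 1) * (‖x‖ * (((n : ℝ) + 1)⁻¹ * ‖x‖)) = ‖x‖ ^ 2 := by
      field_simp
    linarith
  · exact (((((hcomm m n).smul_left _).smul_right _).sub_left (Commute.one_left _)).sub_right
      (Commute.one_right _)).smul_left _ |>.smul_right _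
  · refine (hlim y).congr fun n => ?_
    rw [hY]
    have := hR' n _ _ h
    rw [map_sub, map_smul, sub_eq_iff_eq_add] at this
    rw [this]
    congr 1; abel

end IsMDissipative

end LumerPhillips

end

section

/-! ### Generation of the semigroup from the Yosida approximations, and decay from a Lyapunov form
-/

section Generation

variable {X : Type*} [NormedAddCommGroup X] [InnerProductSpace ℝ X] [CompleteSpace X]
  {G : Submodule ℝ (X × X)}

/-- On the domain the commuting comparison bounds the difference by `T ‖Y m x' - Y n x'‖`; density
and contractivity handle general `x`. -/
lemma uniformCauchySeqOn_exp (hG : IsMDissipative G) {Y : ℕ → X →L[ℝ] X}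
    (hY : ∀ n x, ⟪x, Y n x⟫ ≤ 0) (hYc : ∀ m n, Commute (Y m) (Y n))
    (hYG : ∀ x y, (x, y) ∈ G → Tendsto (fun n => Y n x) atTop (𝓝 y)) (x : X) {T : ℝ}
    (hT : 0 < T) :
    UniformCauchySeqOn (fun n t => NormedSpace.exp (t • Y n) x) atTop (Icc 0 T) := by
  rw [Metric.uniformCauchySeqOn_iff]
  intro ε hε
  obtain ⟨x', y', hxy, hx⟩ := hG.dense_domain x (ε := ε / 3) (by positivity)
  obtain ⟨N, hN⟩ := Metric.cauchySeq_iff.1 (hYG x' y' hxy).cauchySeq (ε / 3 / T) (by positivity)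
  refine ⟨N, fun m hm n hn t ht => ?_⟩
  have h1 := hN m hm n hn
  rw [dist_eq_norm, lt_div_iff₀ hT] at h1
  have h2 := norm_exp_sub_exp_le (hY m) (hY n) (hYc m n) ht.1 x'
  have h3 := norm_exp_smul_apply_le (hY m) ht.1 (x - x')
  have h4 := norm_exp_smul_apply_le (hY n) ht.1 (x - x')
  have h5 : t * ‖Y m x' - Y n x'‖ ≤ ‖Y m x' - Y n x'‖ * T := by
    rw [mul_comm]; exact mul_le_mul_of_nonneg_left ht.2 (norm_nonneg _)
  rw [dist_eq_norm]
  have he : NormedSpace.exp (t • Y m) x - NormedSpace.exp (t • Y n) x =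
      NormedSpace.exp (t • Y m) (x - x') +
        (NormedSpace.exp (t • Y m) x' - NormedSpace.exp (t • Y n) x') -
        NormedSpace.exp (t • Y n) (x - x') := by
    rw [map_sub, map_sub]; abel
  rw [he]
  have h6 := norm_sub_le (NormedSpace.exp (t • Y m) (x - x') +
        (NormedSpace.exp (t • Y m) x' - NormedSpace.exp (t • Y n) x'))
        (NormedSpace.exp (t • Y n) (x - x'))
  have h7 := norm_add_le (NormedSpace.exp (t • Y m) (x - x'))
        (NormedSpace.exp (t • Y m) x' - NormedSpace.exp (t • Y n) x')
  linarith

/-- **Lumer–Phillips theorem**: an `m`-dissipative operator generates a strongly continuous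
semigroup. -/
theorem IsMDissipative.exists_semigroup (hG : IsMDissipative G) :
    ∃ S : ℝ≥0 → X →L[ℝ] X, IsGeneratedBy S (fun x y => (x, y) ∈ G) := by
  obtain ⟨Y, hY, hYc, hYG⟩ := hG.exists_yosida
  have hcau := fun x T hT => uniformCauchySeqOn_exp hG hY hYc hYG x (T := T) hT
  have hex : ∀ (t : ℝ≥0) x, ∃ y, Tendsto (fun n => NormedSpace.exp ((t : ℝ) • Y n) x) atTop (𝓝 y) :=
    fun t x => cauchySeq_tendsto_of_complete
      ((hcau x (t + 1) (by positivity)).cauchySeq ⟨t.2, by simp⟩)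
  choose f hf using hex
  let S : ℝ≥0 → X →L[ℝ] X := fun t =>
    continuousLinearMapOfTendsto (fun n => NormedSpace.exp ((t : ℝ) • Y n)) (f := f t)
      (tendsto_pi_nhds.2 (hf t))
  have hS : ∀ (t : ℝ≥0) x, Tendsto (fun n => NormedSpace.exp ((t : ℝ) • Y n) x) atTop (𝓝 (S t x)) := hf
  have hunif : ∀ x T, 0 < T → TendstoUniformlyOn (fun n t => NormedSpace.exp (t • Y n) x)
      (fun t : ℝ => S t.toNNReal x) atTop (Icc 0 T) := fun x T hT =>
    (hcau x T hT).tendstoUniformlyOn_of_tendsto fun t ht => by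
      simpa only [Real.coe_toNNReal t ht.1] using hS t.toNNReal x
  have hcontr : ∀ t x, ‖S t x‖ ≤ ‖x‖ := fun t x =>
    le_of_tendsto (hS t x).norm (Eventually.of_forall fun n => norm_exp_smul_apply_le (hY n) t.2 x)
  have hcont : ∀ x, Continuous fun t => S t x := by
    intro x
    rw [continuous_iff_continuousAt]
    intro t
    have h1 : ContinuousOn (fun t : ℝ => S t.toNNReal x) (Icc 0 ((t : ℝ) + 1)) :=
      (hunif x _ (by positivity)).continuousOn (Frequently.of_forall fun n s _ =>
        (hasDerivAt_exp_smul_apply (Y n) x s).continuousAt.continuousWithinAt)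
    have h2 : ContinuousOn (fun s : ℝ≥0 => S (s : ℝ).toNNReal x) (Iic (t + 1)) :=
      h1.comp NNReal.continuous_coe.continuousOn fun s hs => ⟨s.2, by exact_mod_cast hs⟩
    simp only [Real.toNNReal_coe] at h2
    exact h2.continuousAt (Iic_mem_nhds (by simp))
  have hzero : S 0 = ContinuousLinearMap.id ℝ X := by
    ext x
    refine tendsto_nhds_unique (hS 0 x) ?_
    simp
  have hadd : ∀ s t, S (s + t) = (S s).comp (S t) := by
    intro s t
    ext x
    refine tendsto_nhds_unique (hS (s + t) x) ?_
    have h1 : Tendsto (fun n => NormedSpace.exp ((s : ℝ) • Y n)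
        (NormedSpace.exp ((t : ℝ) • Y n) x - S t x)) atTop (𝓝 0) := by
      refine squeeze_zero_norm (fun n => norm_exp_smul_apply_le (hY n) s.2 _) ?_
      simpa using ((hS t x).sub_const (S t x)).norm
    have h2 := h1.add (hS s (S t x))
    rw [zero_add] at h2
    refine h2.congr fun n => ?_
    rw [map_sub, sub_add_cancel, NNReal.coe_add, exp_add_smul_apply]
  have hgen : ∀ x y, (x, y) ∈ G →
      Tendsto (fun h : ℝ≥0 => (h : ℝ)⁻¹ • (S h x - x)) (𝓝[>] 0) (𝓝 y) := by
    intro x y hxy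
    rw [Metric.tendsto_nhds]
    intro ε hε
    have h1 : Tendsto (fun t => S t y) (𝓝 0) (𝓝 y) := by
      have := (hcont y).tendsto 0
      rwa [hzero] at this
    obtain ⟨T, hT, hT'⟩ := Metric.eventually_nhds_iff.1
      (Metric.tendsto_nhds.1 h1 (ε / 8) (by positivity))
    have hTn : Iio (⟨T, hT.le⟩ : ℝ≥0) ∈ 𝓝 (0 : ℝ≥0) := Iio_mem_nhds hT
    filter_upwards [self_mem_nhdsWithin, mem_nhdsWithin_of_mem_nhds hTn] with h hh hhT
    have hh' : (0 : ℝ) < h := hh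
    have hhT' : (h : ℝ) < T := hhT
    have hev := (Metric.tendstoUniformlyOn_iff.1 (hunif y T hT) (ε / 8) (by positivity)).and
      (Metric.tendsto_nhds.1 (hYG x y hxy) (ε / 8) (by positivity))
    have hbound : ∀ᶠ n in atTop,
        ‖NormedSpace.exp ((h : ℝ) • Y n) x - (h : ℝ) • y - x‖ ≤ ε / 2 * h := by
      filter_upwards [hev] with n hn
      -- The mean value inequality for `e^{tY_n} x - t y`. Its derivative splits into three pieces
      -- below `ε / 8`, uniformly in `t < h` and for all large `n`, so the bound survives the limit
      -- in `n`.
      have := norm_image_sub_le_of_norm_deriv_le_segment'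
        (f := fun t : ℝ => NormedSpace.exp (t • Y n) x - t • y)
        (f' := fun t => NormedSpace.exp (t • Y n) (Y n x) - y) (a := 0) (b := h) (C := ε / 2)
        (fun t _ => by
          have := (hasDerivAt_exp_smul_apply (Y n) x t).sub ((hasDerivAt_id t).smul_const y)
          simpa using! this.hasDerivWithinAt) (fun t ht => ?_) h (right_mem_Icc.2 hh'.le)
      · simpa using this
      · have a1 := norm_exp_smul_apply_le (hY n) ht.1 (Y n x - y)
        have a2 := hn.2
        have a3 := hn.1 t ⟨ht.1, (ht.2.trans hhT').le⟩
        have a4 := @hT' t.toNNReal (by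
          rw [NNReal.dist_eq, Real.coe_toNNReal t ht.1]
          simpa [abs_of_nonneg ht.1] using ht.2.trans hhT')
        rw [dist_eq_norm] at a2 a3 a4
        rw [norm_sub_rev] at a3
        have he : NormedSpace.exp (t • Y n) (Y n x) - y =
            NormedSpace.exp (t • Y n) (Y n x - y) + (NormedSpace.exp (t • Y n) y
              - S t.toNNReal y) + (S t.toNNReal y - y) := by rw [map_sub]; abel
        rw [he]
        refine (norm_add₃_le).trans ?_
        linarith
    have hlim : ‖S h x - (h : ℝ) • y - x‖ ≤ ε / 2 * h :=
      le_of_tendsto (((hS h x).sub_const _).sub_const _).norm hbound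
    have he : (h : ℝ)⁻¹ • (S h x - x) - y = (h : ℝ)⁻¹ • (S h x - (h : ℝ) • y - x) := by
      rw [sub_right_comm, smul_sub _ (S h x - x), inv_smul_smul₀ hh'.ne']
    rw [dist_eq_norm, he, norm_smul, norm_inv, Real.norm_of_nonneg hh'.le, inv_mul_lt_iff₀ hh']
    nlinarith
  refine ⟨S, ⟨⟨hzero, hadd, hcont⟩, fun x y => ⟨hgen x y, fun hxy => ?_⟩⟩⟩
  -- Maximality: with `p - q = x - y`, the difference quotients at `x - p` converge to `y - q = x -
  -- p`. Contractivity forces `‖x - p‖² ≤ 0`, so the generator is no larger than `G`.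
  obtain ⟨p, q, hpq, he⟩ := hG.range 1 one_pos (x - y)
  rw [one_smul] at he
  have h1 := hxy.sub (hgen p q hpq)
  have h2 : ⟪x - p, y - q⟫ ≤ 0 := by
    refine le_of_tendsto (tendsto_const_nhds.inner h1) (Eventually.of_forall fun h => ?_)
    rw [← smul_sub, sub_sub_sub_comm, ← map_sub, real_inner_smul_right, inner_sub_right,
      real_inner_self_eq_norm_sq]
    refine mul_nonpos_of_nonneg_of_nonpos (inv_nonneg.2 h.2) ?_
    have := real_inner_le_norm (x - p) (S h (x - p))
    have := mul_le_mul_of_nonneg_left (hcontr h (x - p)) (norm_nonneg (x - p))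
    linarith
  have h3 : y - q = x - p := by rw [sub_eq_sub_iff_sub_eq_sub, ← neg_sub, ← he, neg_sub]
  rw [h3, real_inner_self_nonpos, sub_eq_zero] at h2
  subst h2
  have h4 : y = q := by simpa using he.symm
  rwa [h4]

/-- Exponential decay from a quadratic Lyapunov functional. -/
theorem IsGeneratedBy.norm_le_of_lyapunov {X : Type*} [NormedAddCommGroup X]
    [InnerProductSpace ℝ X] {S : ℝ≥0 → X →L[ℝ] X} {G : X → X → Prop}
    (hS : IsGeneratedBy S G) (b : X →L[ℝ] X →L[ℝ] ℝ) {m M ω : ℝ} (hm : 0 < m)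
    (hbm : ∀ x, m * ‖x‖ ^ 2 ≤ b x x) (hbM : ∀ x, b x x ≤ M * ‖x‖ ^ 2)
    (hω : ∀ x y, G x y → b x y + b y x ≤ -2 * ω * b x x)
    (hd : ∀ x, ∀ ε > 0, ∃ x' y', G x' y' ∧ ‖x - x'‖ < ε) (t : ℝ≥0) (x : X) :
    ‖S t x‖ ≤ √(M / m) * ‖x‖ * Real.exp (-ω * t) := by
  have hdom : ∀ x y, G x y → ‖S t x‖ ≤ √(M / m) * ‖x‖ * Real.exp (-ω * t) := by
    intro x y hxy
    -- The semigroup leaves the domain invariant and commutes with its generator.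
    have hG : ∀ s : ℝ≥0, G (S s x) (S s y) := by
      intro s
      rw [hS.generator]
      have h1 := ((S s).continuous.tendsto y).comp ((hS.generator x y).1 hxy)
      refine h1.congr fun h => ?_
      have : S h (S s x) = S s (S h x) := by
        rw [← ContinuousLinearMap.comp_apply, ← hS.add, add_comm, hS.add]; rfl
      simp [this]
    have hder : ∀ s : ℝ, 0 ≤ s →
        HasDerivWithinAt (fun r : ℝ => S r.toNNReal x) (S s.toNNReal y) (Ici s) s := by
      intro s hs
      rw [← hasDerivWithinAt_Ioi_iff_Ici, hasDerivWithinAt_iff_tendsto_slope' (by simp)]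
      have h1 := (hS.generator _ _).1 (hG s.toNNReal)
      have h2 : Tendsto (fun r : ℝ => (r - s).toNNReal) (𝓝[>] s) (𝓝[>] 0) := by
        refine tendsto_nhdsWithin_iff.2 ⟨?_, ?_⟩
        · have : Continuous fun r : ℝ => (r - s).toNNReal := by fun_prop
          have := this.tendsto s
          simp only [sub_self, Real.toNNReal_zero] at this
          exact this.mono_left nhdsWithin_le_nhds
        · filter_upwards [self_mem_nhdsWithin] with r hr
          simpa using hr
      refine (h1.comp h2).congr' ?_
      filter_upwards [self_mem_nhdsWithin] with r hr
      have hr' : s < r := hr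
      have h3 : r.toNNReal = (r - s).toNNReal + s.toNNReal := by
        rw [← Real.toNNReal_add (sub_nonneg.2 hr'.le) hs, sub_add_cancel]
      simp only [Function.comp_apply, slope, vsub_eq_sub]
      rw [h3, hS.add, Real.coe_toNNReal _ (sub_nonneg.2 hr'.le)]
      rfl
    have hcont : ContinuousOn (fun r : ℝ => S r.toNNReal x) (Icc 0 t) :=
      ((hS.continuous x).comp continuous_real_toNNReal).continuousOn
    have hb : ∀ r : ℝ, 0 ≤ r → HasDerivWithinAt (fun r : ℝ => b (S r.toNNReal x) (S r.toNNReal x))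
        (b (S r.toNNReal x) (S r.toNNReal y) + b (S r.toNNReal y) (S r.toNNReal x)) (Ici r) r := by
      intro r hr
      have h1 : HasDerivWithinAt (fun r : ℝ => b (S r.toNNReal x)) (b (S r.toNNReal y)) (Ici r) r :=
        b.hasFDerivAt.comp_hasDerivWithinAt r (hder r hr)
      have := h1.clm_apply (hder r hr)
      rwa [add_comm] at this
    -- `e^{2ωr} b(S x, S x)` has nonpositive right derivative; right derivatives suffice for the
    -- comparison. As `b` need not be symmetric, both orders of its arguments occur.
    have hmain := image_le_of_deriv_right_le_deriv_boundary
      (f := fun r : ℝ => b (S r.toNNReal x) (S r.toNNReal x) * Real.exp (2 * ω * r))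
      (a := 0) (b := t) (B := fun _ => b x x) (B' := fun _ => 0)
      (((b.continuous.comp_continuousOn hcont).clm_apply hcont).mul (by fun_prop))
      (fun r hr => (hb r hr.1).mul
        (((hasDerivAt_id r).const_mul (2 * ω)).exp.hasDerivWithinAt))
      (by simp [hS.zero]) continuousOn_const (fun r _ => hasDerivWithinAt_const _ _ _)
      (fun r hr => by
        have h1 := hω _ _ (hG r.toNNReal)
        have h2 := mul_le_mul_of_nonneg_right h1 (Real.exp_pos (2 * ω * r)).le
        simp only [id]
        linarith) (right_mem_Icc.2 t.2)
    simp only [Real.toNNReal_coe] at hmain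
    have h1 : m * ‖S t x‖ ^ 2 * Real.exp (2 * ω * t) ≤ M * ‖x‖ ^ 2 :=
      (mul_le_mul_of_nonneg_right (hbm _) (Real.exp_pos _).le).trans (hmain.trans (hbM x))
    have hMx : 0 ≤ M * ‖x‖ ^ 2 := le_trans (by positivity) h1
    have h2 : (√(M / m) * ‖x‖) ^ 2 = M / m * ‖x‖ ^ 2 := by
      -- The sign of `M` is only known once some nonzero vector exists.
      rcases eq_or_ne x 0 with rfl | hx
      · simp
      have : 0 ≤ M := nonneg_of_mul_nonneg_left hMx (by positivity)
      rw [mul_pow, Real.sq_sqrt (by positivity)]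
    refine le_of_sq_le_sq ?_ (by positivity)
    rw [mul_pow, h2, ← Real.exp_nat_mul]
    have h3 : Real.exp (((2 : ℕ) : ℝ) * (-ω * t)) = (Real.exp (2 * ω * t))⁻¹ := by
      rw [← Real.exp_neg]; congr 1; push_cast; ring
    rw [h3, ← div_eq_mul_inv, le_div_iff₀ (Real.exp_pos _), div_mul_eq_mul_div, le_div_iff₀ hm]
    linarith
  refine le_of_forall_pos_le_add fun ε hε => ?_
  set C := √(M / m) * Real.exp (-ω * t) with hC
  have hC0 : 0 ≤ C := by positivity
  -- Replacing `x` by `x'` costs at most `(‖S t‖ + C) ‖x - x'‖`.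
  obtain ⟨x', y', hxy, hx⟩ := hd x (ε / (‖S t‖ + C + 1)) (by positivity)
  have h1 := hdom x' y' hxy
  have h2 : ‖S t x‖ ≤ ‖S t (x - x')‖ + ‖S t x'‖ := by
    have := norm_add_le (S t (x - x')) (S t x')
    rwa [← map_add, sub_add_cancel] at this
  have h3 := (S t).le_opNorm (x - x')
  have h4 : ‖x'‖ ≤ ‖x‖ + ‖x - x'‖ := by
    have := norm_sub_le x (x - x')
    rwa [sub_sub_cancel] at this
  have h5 := mul_le_mul_of_nonneg_left h4 hC0
  rw [lt_div_iff₀ (by positivity)] at hx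
  have h6 : √(M / m) * ‖x'‖ * Real.exp (-ω * t) = C * ‖x'‖ := by rw [hC]; ring
  have h7 : √(M / m) * ‖x‖ * Real.exp (-ω * t) = C * ‖x‖ := by rw [hC]; ring
  rw [h7]; rw [h6] at h1
  nlinarith [norm_nonneg (x - x')]

end Generation

end

section

/-! ### Spectral decomposition and the space `V` -/

namespace PosOperator

variable {H : Type u} [NormedAddCommGroup H] [InnerProductSpace ℝ H] [CompleteSpace H]
  (A : PosOperator H)

lemma eigenproj_mem (c : ℝ) (x : H) : A.eigenproj c x ∈ A.eigenspace c :=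
  (A.eigenspace c).starProjection_apply_mem x

lemma eigenproj_of_mem {c : ℝ} {x : H} (hx : x ∈ A.eigenspace c) : A.eigenproj c x = x :=
  Submodule.starProjection_eq_self_iff.2 hx

lemma inner_eigenproj_left (c : ℝ) (x y : H) : ⟪A.eigenproj c x, y⟫ = ⟪x, A.eigenproj c y⟫ :=
  Submodule.inner_starProjection_left_eq_right _ x y

lemma eigenproj_of_mem_of_ne {c d : ℝ} (h : d ≠ c) {x : H} (hx : x ∈ A.eigenspace d) :
    A.eigenproj c x = 0 := by
  rw [← inner_self_eq_zero (𝕜 := ℝ)]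
  have h1 : ⟪A.eigenproj c x, A.eigenproj c x⟫ = ⟪x, A.eigenproj c x⟫ := by
    rw [inner_eigenproj_left, A.eigenproj_of_mem (A.eigenproj_mem c x)]
  rw [h1]
  exact A.eigenspace_orthogonal h hx (A.eigenproj_mem c x)

lemma inner_eigenproj_eigenproj (c : ℝ) (x y : H) :
    ⟪A.eigenproj c x, A.eigenproj c y⟫ = ⟪x, A.eigenproj c y⟫ := by
  rw [inner_eigenproj_left, A.eigenproj_of_mem (A.eigenproj_mem c y)]

lemma eigenproj_of_nonpos {c : ℝ} (hc : c ≤ 0) (x : H) : A.eigenproj c x = 0 :=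
  A.eigenspace_nonpos hc (A.eigenproj_mem c x)

lemma orthogonalFamily_eigenspace :
    OrthogonalFamily ℝ (fun c : ℝ => A.eigenspace c) fun c => (A.eigenspace c).subtypeₗᵢ :=
  fun _ _ hcd x y => A.eigenspace_orthogonal hcd x.2 y.2

lemma summable_smul_eigenproj_iff (a : ℝ → ℝ) (x : H) :
    (Summable fun c => a c • A.eigenproj c x) ↔
      Summable fun c => a c ^ 2 * ‖A.eigenproj c x‖ ^ 2 := by
  have h := A.orthogonalFamily_eigenspace.summable_iff_norm_sq_summable
    (fun c => a c • ⟨A.eigenproj c x, A.eigenproj_mem c x⟩)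
  simpa [norm_smul, mul_pow] using h

/-- The coefficients of an expansion along the eigenspaces. -/
lemma eigenproj_of_hasSum {f : ℝ → H} (hf : ∀ c, f c ∈ A.eigenspace c) {y : H} (h : HasSum f y)
    (c : ℝ) : A.eigenproj c y = f c := by
  refine (h.mapL (A.eigenproj c)).unique ?_
  have := hasSum_single (f := fun d => A.eigenproj c (f d)) c
    fun d hd => A.eigenproj_of_mem_of_ne hd (hf d)
  simpa only [A.eigenproj_of_mem (hf c)] using this

/-- Bessel's inequality. -/
lemma summable_norm_eigenproj_sq (x : H) : Summable fun c => ‖A.eigenproj c x‖ ^ 2 := by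
  refine summable_of_sum_le (c := ‖x‖ ^ 2) (fun c => by positivity) fun s => ?_
  have h1 : ‖∑ c ∈ s, A.eigenproj c x‖ ^ 2 = ∑ c ∈ s, ‖A.eigenproj c x‖ ^ 2 :=
    A.orthogonalFamily_eigenspace.norm_sum (fun c => ⟨A.eigenproj c x, A.eigenproj_mem c x⟩) s
  have h2 : ⟪x, ∑ c ∈ s, A.eigenproj c x⟫ = ∑ c ∈ s, ‖A.eigenproj c x‖ ^ 2 := by
    rw [inner_sum]
    refine Finset.sum_congr rfl fun c _ => ?_
    rw [← inner_eigenproj_eigenproj, real_inner_self_eq_norm_sq]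
  have h3 := real_inner_le_norm x (∑ c ∈ s, A.eigenproj c x)
  rw [h2, ← h1] at h3
  rw [← h1]
  nlinarith [norm_nonneg x, norm_nonneg (∑ c ∈ s, A.eigenproj c x),
    sq_nonneg (‖x‖ - ‖∑ c ∈ s, A.eigenproj c x‖)]

/-- Bessel gives convergence of the series, and the remainder is killed by every eigenprojection;
completeness of the eigenspaces makes it zero. -/
lemma hasSum_eigenproj (x : H) : HasSum (fun c => A.eigenproj c x) x := by
  have hs : Summable fun c => A.eigenproj c x := by
    have := (A.summable_smul_eigenproj_iff (fun _ => 1) x).2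
      (by simpa using A.summable_norm_eigenproj_sq x)
    simpa using this
  have h : x - ∑' c, A.eigenproj c x = 0 := A.eq_zero_of_eigenproj fun c => by
    rw [map_sub, A.eigenproj_of_hasSum (fun c => A.eigenproj_mem c x) hs.hasSum, sub_self]
  rw [sub_eq_zero.1 h]
  simpa only [← sub_eq_zero.1 h] using hs.hasSum

/-- Parseval's identity. -/
lemma hasSum_inner_eigenproj (x y : H) :
    HasSum (fun c => ⟪A.eigenproj c x, A.eigenproj c y⟫) ⟪x, y⟫ := by
  simp_rw [inner_eigenproj_eigenproj]
  exact (A.hasSum_eigenproj y).mapL (innerSL ℝ x)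

lemma hasSum_norm_eigenproj_sq (x : H) : HasSum (fun c => ‖A.eigenproj c x‖ ^ 2) (‖x‖ ^ 2) := by
  simpa only [real_inner_self_eq_norm_sq] using A.hasSum_inner_eigenproj x x

lemma incl_injective : Function.Injective A.incl := Subtype.val_injective

lemma inner_V (u w : A.V) : ⟪u, w⟫ = ⟪A.sqrtV u, A.sqrtV w⟫ := rfl

lemma hasSum_sqrtV (u : A.V) : HasSum (fun c : ℝ => √c • A.eigenproj c (A.incl u)) (A.sqrtV u) :=
  (show Summable fun c : ℝ => √c • A.eigenproj c (A.incl u) from u.2).hasSum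

lemma exists_incl_eq {x : H} (h : Summable fun c : ℝ => √c ^ 2 * ‖A.eigenproj c x‖ ^ 2) :
    ∃ u : A.V, A.incl u = x :=
  ⟨⟨x, (A.summable_smul_eigenproj_iff _ x).2 h⟩, rfl⟩

lemma eigenproj_sqrtV (u : A.V) (c : ℝ) :
    A.eigenproj c (A.sqrtV u) = √c • A.eigenproj c (A.incl u) :=
  A.eigenproj_of_hasSum (fun c => (A.eigenspace c).smul_mem _ (A.eigenproj_mem c _))
    (A.hasSum_sqrtV u) c

/-- An eigenvector satisfies `x = B (c x)`, so `1 ≤ ‖B‖ c`: the spectrum stays away from `0`.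
Written with projections, the bound holds trivially when `c` is not an eigenvalue. -/
lemma exists_eigenvalue_bound :
    ∃ C : ℝ, 0 ≤ C ∧ ∀ c : ℝ, ∀ x, ‖A.eigenproj c x‖ ^ 2 ≤ C * (√c ^ 2 * ‖A.eigenproj c x‖ ^ 2) := by
  obtain ⟨B, -, -, hB⟩ := A.compact_inverse
  refine ⟨‖B‖, norm_nonneg _, fun c x => ?_⟩
  rcases le_or_gt c 0 with hc | hc
  · simp [A.eigenproj_of_nonpos hc]
  obtain ⟨a, ha, ha'⟩ := A.op.mem_graph_iff.1 (A.mem_eigenspace.1 (A.eigenproj_mem c x))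
  simp only at ha ha'
  have h1 := hB a
  rw [ha', ha] at h1
  have h2 := B.le_opNorm (c • A.eigenproj c x)
  rw [h1, norm_smul, Real.norm_of_nonneg hc.le] at h2
  rw [Real.sq_sqrt hc.le]
  nlinarith [norm_nonneg (A.eigenproj c x)]

/-- The preimage is `∑ (√c)⁻¹ P_c y`, convergent because the eigenvalues are bounded below. This
makes `V` isometric to `H`, hence complete. -/
lemma sqrtV_surjective : Function.Surjective A.sqrtV := by
  intro y
  obtain ⟨C, hC, hb⟩ := A.exists_eigenvalue_bound
  have hs : Summable fun c : ℝ => (√c)⁻¹ • A.eigenproj c y := by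
    rw [A.summable_smul_eigenproj_iff]
    refine Summable.of_nonneg_of_le (fun c => by positivity) (fun c => ?_)
      ((A.summable_norm_eigenproj_sq y).mul_left C)
    rcases le_or_gt c 0 with hc | hc
    · simp [A.eigenproj_of_nonpos hc]
    have hc' := Real.sqrt_pos.2 hc
    have := hb c y
    rw [inv_pow, inv_mul_le_iff₀ (by positivity)]
    linarith
  have hp := A.eigenproj_of_hasSum (fun c => (A.eigenspace c).smul_mem _ (A.eigenproj_mem c y))
    hs.hasSum
  have hsq : ∀ c : ℝ, √c • A.eigenproj c (∑' c : ℝ, (√c)⁻¹ • A.eigenproj c y) =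
      A.eigenproj c y := by
    intro c
    rcases le_or_gt c 0 with hc | hc
    · simp [A.eigenproj_of_nonpos hc]
    rw [hp, smul_inv_smul₀ (Real.sqrt_pos.2 hc).ne']
  refine ⟨⟨∑' c : ℝ, (√c)⁻¹ • A.eigenproj c y, ?_⟩, ?_⟩
  · change Summable _
    simp_rw [hsq]
    exact (A.hasSum_eigenproj y).summable
  · refine (A.hasSum_sqrtV _).unique ?_
    change HasSum (fun c : ℝ => √c • A.eigenproj c (∑' c : ℝ, (√c)⁻¹ • A.eigenproj c y)) y
    simp_rw [hsq]
    exact A.hasSum_eigenproj y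

/-- `A^{1/2}` as an isometry of `V` onto `H`. -/
def sqrtIso : A.V ≃ₗᵢ[ℝ] H :=
  LinearIsometryEquiv.ofSurjective ⟨A.sqrtV, fun u => (A.norm_V u).symm⟩ A.sqrtV_surjective

instance : CompleteSpace A.V :=
  (completeSpace_congr (e := A.sqrtIso.toEquiv) A.sqrtIso.isometry.isUniformEmbedding).2
    inferInstance

lemma exists_norm_incl_le : ∃ C : ℝ, ∀ u : A.V, ‖A.incl u‖ ≤ C * ‖u‖ := by
  obtain ⟨C, hC, hb⟩ := A.exists_eigenvalue_bound
  refine ⟨√C, fun u => ?_⟩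
  have h1 := A.hasSum_norm_eigenproj_sq (A.incl u)
  have h2 := (A.hasSum_norm_eigenproj_sq (A.sqrtV u)).mul_left C
  have h3 := hasSum_le (fun c => by
    rw [A.eigenproj_sqrtV, norm_smul, mul_pow, Real.norm_of_nonneg (Real.sqrt_nonneg c)]
    exact hb c _) h1 h2
  refine le_of_sq_le_sq ?_ (by positivity)
  rw [mul_pow, Real.sq_sqrt hC, norm_V]
  exact h3

/-- The bounded inclusion of `V` in `H`. -/
def inclL : A.V →L[ℝ] H :=
  ⟨A.incl, by
    obtain ⟨C, hC⟩ := A.exists_norm_incl_le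
    exact (A.incl.mkContinuous C hC).continuous⟩

@[simp] lemma inclL_apply (u : A.V) : A.inclL u = A.incl u := rfl

/-- Symmetry of `A`, tested against eigenvectors. -/
lemma eigenproj_of_mem_graph {x y : H} (h : (x, y) ∈ A.op.graph) (c : ℝ) :
    A.eigenproj c y = c • A.eigenproj c x := by
  refine ext_inner_right ℝ fun z => ?_
  rw [inner_eigenproj_left, real_inner_smul_left, inner_eigenproj_left,
    A.symm_graph h (A.mem_eigenspace.1 (A.eigenproj_mem c z)), real_inner_smul_right]

/-- `D(A) ⊆ V`. -/
lemma exists_incl_of_mem_graph {x y : H} (h : (x, y) ∈ A.op.graph) : ∃ u : A.V, A.incl u = x := by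
  refine A.exists_incl_eq ((A.hasSum_inner_eigenproj y x).summable.congr fun c => ?_)
  rcases le_or_gt c 0 with hc | hc
  · simp [A.eigenproj_of_nonpos hc]
  rw [A.eigenproj_of_mem_graph h, real_inner_smul_left, real_inner_self_eq_norm_sq,
    Real.sq_sqrt hc.le]

/-- `⟪A u, w⟫_H = ⟪u, w⟫_V` for `u ∈ D(A)`, `w ∈ V`. -/
lemma inner_of_mem_graph {u : A.V} {y : H} (h : (A.incl u, y) ∈ A.op.graph) (w : A.V) :
    ⟪y, A.incl w⟫ = ⟪u, w⟫ := by
  rw [A.inner_V]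
  refine (A.hasSum_inner_eigenproj y _).unique
    ((A.hasSum_inner_eigenproj (A.sqrtV u) (A.sqrtV w)).congr_fun fun c => ?_)
  rcases le_or_gt c 0 with hc | hc
  · simp [A.eigenproj_of_nonpos hc]
  rw [A.eigenproj_of_mem_graph h, A.eigenproj_sqrtV, A.eigenproj_sqrtV, real_inner_smul_left,
    real_inner_smul_left, real_inner_smul_right, ← mul_assoc, Real.mul_self_sqrt hc.le]

lemma inner_nonneg_of_mem_graph {x y : H} (h : (x, y) ∈ A.op.graph) : 0 ≤ ⟪y, x⟫ := by
  obtain ⟨u, rfl⟩ := A.exists_incl_of_mem_graph h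
  rw [A.inner_of_mem_graph h]
  exact real_inner_self_nonneg

/-- `A + a` maps onto `H` for `a ≥ 0`. -/
lemma exists_add_smul_eq {a : ℝ} (ha : 0 ≤ a) (f : H) : ∃ x, (x, f - a • x) ∈ A.op.graph := by
  obtain ⟨B, -, hB, -⟩ := A.compact_inverse
  -- Put `x = B g` with `B = A⁻¹`: the equation becomes `g + a B g = f`, bounded and coercive since
  -- `B ≥ 0`, and Lax–Milgram applies.
  let T : H →L[ℝ] H := ContinuousLinearMap.id ℝ H + a • B
  let b : H →L[ℝ] H →L[ℝ] ℝ := (innerSL ℝ).comp T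
  have hb : ∀ x y, b x y = ⟪x + a • B x, y⟫ := fun x y => rfl
  have hco : IsCoercive b := ⟨1, one_pos, fun x => by
    rw [hb, inner_add_left, real_inner_smul_left, real_inner_self_eq_norm_sq, real_inner_comm]
    nlinarith [A.inner_nonneg_of_mem_graph (hB x)]⟩
  obtain ⟨g, hg⟩ := hco.continuousLinearEquivOfBilin.surjective f
  have hg' : g + a • B g = f := ext_inner_right ℝ fun w => by
    rw [← hb, ← hg, IsCoercive.continuousLinearEquivOfBilin_apply]
  refine ⟨B g, ?_⟩
  rw [← hg', add_sub_cancel_right]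
  exact hB g

end PosOperator

end

section

/-! ### The memory kernel and weighted `L²` spaces -/

namespace Kernel

variable (κ : Kernel)

lemma isOpen_Ω : IsOpen κ.Ω :=
  (isOpen_lt continuous_const continuous_id).inter
    (isOpen_lt continuous_coe_real_ereal continuous_const)

lemma measurableSet_Ω : MeasurableSet κ.Ω := κ.isOpen_Ω.measurableSet

lemma pos_of_mem {s : ℝ} (hs : s ∈ κ.Ω) : 0 < s := hs.1

lemma mem_of_le {s t : ℝ} (hs : 0 < s) (hst : s ≤ t) (ht : t ∈ κ.Ω) : s ∈ κ.Ω :=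
  ⟨hs, lt_of_le_of_lt (EReal.coe_le_coe_iff.2 hst) ht.2⟩

lemma Icc_subset {s t : ℝ} (hs : s ∈ κ.Ω) (ht : t ∈ κ.Ω) : Icc s t ⊆ κ.Ω :=
  fun _ hr => κ.mem_of_le (hs.1.trans_le hr.1) hr.2 ht

lemma nonempty_Ω : κ.Ω.Nonempty := by
  obtain ⟨s, h0, h1⟩ := EReal.lt_iff_exists_real_btwn.1 κ.ℓ_pos
  exact ⟨s, by exact_mod_cast h0, h1⟩

lemma ν_pos {s : ℝ} (hs : s ∈ κ.Ω) : 0 < κ.ν s := one_div_pos.2 (κ.pos s hs)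

lemma ν_mul_μ {s : ℝ} (hs : s ∈ κ.Ω) : κ.ν s * κ.μ s = 1 := one_div_mul_cancel (κ.pos s hs).ne'

lemma aemeasurable_μ : AEMeasurable κ.μ (volume.restrict κ.Ω) :=
  aemeasurable_restrict_of_antitoneOn κ.measurableSet_Ω κ.antitoneOn

lemma aemeasurable_ofReal_ν :
    AEMeasurable (fun s => ENNReal.ofReal (κ.ν s)) (volume.restrict κ.Ω) :=
  (κ.aemeasurable_μ.const_div 1).ennreal_ofReal

/-- The density `ν` is positive on `Ω`, so both measures have the same null sets. -/
lemma ae_νMeasure : ae κ.νMeasure = ae (volume.restrict κ.Ω) := by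
  refine le_antisymm (withDensity_absolutelyContinuous _ _).ae_le
    (withDensity_absolutelyContinuous' κ.aemeasurable_ofReal_ν ?_).ae_le
  filter_upwards [ae_restrict_mem κ.measurableSet_Ω] with s hs
  simpa using κ.ν_pos hs

variable {X : Type*} [NormedAddCommGroup X]

lemma aestronglyMeasurable_νMeasure_iff {f : ℝ → X} :
    AEStronglyMeasurable f κ.νMeasure ↔ AEStronglyMeasurable f (volume.restrict κ.Ω) :=
  ⟨fun h => h.mono_ac (Measure.ae_le_iff_absolutelyContinuous.1 κ.ae_νMeasure.ge),
    fun h => h.mono_ac (Measure.ae_le_iff_absolutelyContinuous.1 κ.ae_νMeasure.le)⟩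

lemma lintegral_νMeasure {f : ℝ → ℝ≥0∞} (hf : AEMeasurable f (volume.restrict κ.Ω)) :
    ∫⁻ s, f s ∂κ.νMeasure = ∫⁻ s in κ.Ω, ENNReal.ofReal (κ.ν s) * f s :=
  lintegral_withDensity_eq_lintegral_mul₀ κ.aemeasurable_ofReal_ν hf

variable [NormedSpace ℝ X]

lemma integrable_νMeasure_iff {f : ℝ → X} :
    Integrable f κ.νMeasure ↔ IntegrableOn (fun s => κ.ν s • f s) κ.Ω := by
  rw [νMeasure, integrable_withDensity_iff_integrable_smul₀' κ.aemeasurable_ofReal_ν (by simp)]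
  refine integrable_congr ?_
  filter_upwards [ae_restrict_mem κ.measurableSet_Ω] with s hs
  rw [ENNReal.toReal_ofReal (κ.ν_pos hs).le]

lemma integral_νMeasure (f : ℝ → X) :
    ∫ s, f s ∂κ.νMeasure = ∫ s in κ.Ω, κ.ν s • f s := by
  rw [νMeasure, integral_withDensity_eq_integral_toReal_smul₀ κ.aemeasurable_ofReal_ν (by simp)]
  refine integral_congr_ae ?_
  filter_upwards [ae_restrict_mem κ.measurableSet_Ω] with s hs
  rw [ENNReal.toReal_ofReal (κ.ν_pos hs).le]

/-- `ν (ψ μ)² = ψ² μ`, with `ψ` bounded on `Ω` and `μ` summable. -/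
lemma memLp_mul_μ {ψ : ℝ → ℝ} (hψ : Continuous ψ) {C : ℝ} (hC : ∀ s ∈ κ.Ω, |ψ s| ≤ C) :
    MemLp (fun s => ψ s * κ.μ s) 2 κ.νMeasure := by
  have hm : AEStronglyMeasurable (fun s => ψ s * κ.μ s) (volume.restrict κ.Ω) :=
    hψ.aestronglyMeasurable.mul κ.aemeasurable_μ.aestronglyMeasurable
  rw [memLp_two_iff_integrable_sq (κ.aestronglyMeasurable_νMeasure_iff.2 hm),
    κ.integrable_νMeasure_iff]
  have h := Integrable.bdd_smul (μ := volume.restrict κ.Ω) (f := κ.μ) (φ := fun s => ψ s ^ 2)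
    κ.integrableOn (C ^ 2) (hψ.pow 2).aestronglyMeasurable (by
      filter_upwards [ae_restrict_mem κ.measurableSet_Ω] with s hs
      rw [norm_pow, Real.norm_eq_abs]
      exact pow_le_pow_left₀ (abs_nonneg _) (hC s hs) 2)
  refine h.congr ?_
  filter_upwards [ae_restrict_mem κ.measurableSet_Ω] with s hs
  have := κ.ν_mul_μ hs
  simp only [Pi.smul_apply', smul_eq_mul]
  linear_combination -(ψ s ^ 2 * κ.μ s) * this

lemma memLp_μ : MemLp κ.μ 2 κ.νMeasure := by
  simpa using κ.memLp_mul_μ (ψ := fun _ => 1) continuous_const (C := 1) (by simp)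

/-- `f = ν (μ f)`, and `μ f` is `ν`-integrable as a product of two functions in `L²_ν`. -/
lemma integrableOn_of_memLp {f : ℝ → X} (hf : MemLp f 2 κ.νMeasure) : IntegrableOn f κ.Ω := by
  have h : Integrable (κ.μ • f) κ.νMeasure := memLp_one_iff_integrable.1 (hf.smul κ.memLp_μ)
  rw [κ.integrable_νMeasure_iff] at h
  refine h.congr ?_
  filter_upwards [ae_restrict_mem κ.measurableSet_Ω] with s hs
  simp only [Pi.smul_apply', smul_smul, κ.ν_mul_μ hs, one_smul]

lemma integrableOn_coe (ξ : Lp X 2 κ.νMeasure) : IntegrableOn ξ κ.Ω :=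
  κ.integrableOn_of_memLp (Lp.memLp ξ)

/-- The differential inequality `μ' + δ μ ≤ 0` in integrated form. -/
lemma exp_mul_ν_le {δ : ℝ}
    (hμ : ∀ᵐ s ∂volume.restrict κ.Ω, deriv κ.μ s + δ * κ.μ s ≤ 0) {s t : ℝ} (hs : s ∈ κ.Ω)
    (ht : t ∈ κ.Ω) (hst : s ≤ t) : Real.exp (δ * (t - s)) * κ.ν s ≤ κ.ν t := by
  have hsub := κ.Icc_subset hs ht
  have hac : AbsolutelyContinuousOnInterval κ.μ s t := κ.absCont s t hst hsub
  have hexp : AbsolutelyContinuousOnInterval (fun r => Real.exp (δ * r)) s t :=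
    ContDiffOn.absolutelyContinuousOnInterval (by fun_prop)
  -- Absolute continuity turns the a.e. sign of `(e^{δr} μ)'` into monotonicity of `e^{δr} μ`.
  have hint := (hexp.mul hac).integral_deriv_eq_sub
  have hneg : ∀ᵐ r ∂volume.restrict (Icc s t),
      0 ≤ -deriv ((fun r => Real.exp (δ * r)) * κ.μ) r := by
    have hμ' := ae_restrict_of_ae_restrict_of_subset hsub hμ
    filter_upwards [hμ', ae_restrict_of_ae hac.ae_differentiableAt,
      ae_restrict_mem measurableSet_Icc] with r h1 h2 hr
    have hd := h2 (by rwa [uIcc_of_le hst])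
    have he : HasDerivAt (fun r => Real.exp (δ * r)) (Real.exp (δ * r) * δ) r := by
      simpa using ((hasDerivAt_id r).const_mul δ).exp
    rw [(he.mul hd.hasDerivAt).deriv]
    nlinarith [Real.exp_pos (δ * r)]
  have h0 := intervalIntegral.integral_nonneg_of_ae_restrict hst hneg
  rw [intervalIntegral.integral_neg, hint] at h0
  simp only [Pi.mul_apply] at h0
  have h1 : Real.exp (δ * (t - s)) * κ.μ t ≤ κ.μ s := by
    rw [mul_sub, Real.exp_sub, div_mul_eq_mul_div, div_le_iff₀ (Real.exp_pos _)]
    linarith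
  rw [ν, ν, mul_one_div, div_le_div_iff₀ (κ.pos s hs) (κ.pos t ht), one_mul]
  exact h1

end Kernel

/-! ### Weighted integrals as adjoints in the weighted space -/

section Moments

variable {κ : Kernel} {X : Type*} [NormedAddCommGroup X] [InnerProductSpace ℝ X]

/-- The map `x ↦ a(·) x` from `X` to `L²_ν(Ω; X)`, for `a ∈ L²_ν(Ω)`. -/
def constLp {a : ℝ → ℝ} (ha : MemLp a 2 κ.νMeasure) : X →L[ℝ] Lp X 2 κ.νMeasure :=
  LinearMap.mkContinuous
    { toFun := fun x => ((memLp_top_const x).smul ha : MemLp (a • fun _ => x) 2 κ.νMeasure).toLp _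
      map_add' := fun x y => by
        rw [← MemLp.toLp_add]
        exact MemLp.toLp_congr _ _ (ae_of_all _ fun s => smul_add _ _ _)
      map_smul' := fun c x => by
        rw [RingHom.id_apply, ← MemLp.toLp_const_smul]
        exact MemLp.toLp_congr _ _ (ae_of_all _ fun s => smul_comm _ _ _) }
    (eLpNorm a 2 κ.νMeasure).toReal fun x => by
      simp only [LinearMap.coe_mk, AddHom.coe_mk, Lp.norm_toLp]
      have : eLpNorm (a • fun _ => x) 2 κ.νMeasure = eLpNorm (‖x‖ • a) 2 κ.νMeasure :=
        eLpNorm_congr_norm_ae (ae_of_all _ fun s => by simp [norm_smul, mul_comm])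
      rw [this, eLpNorm_const_smul, ENNReal.toReal_mul, mul_comm]
      simp

lemma coeFn_constLp {a : ℝ → ℝ} (ha : MemLp a 2 κ.νMeasure) (x : X) :
    constLp ha x =ᵐ[volume.restrict κ.Ω] fun s => a s • x := by
  have := MemLp.coeFn_toLp ((memLp_top_const x).smul ha : MemLp (a • fun _ => x) 2 κ.νMeasure)
  rwa [Filter.EventuallyEq, κ.ae_νMeasure] at this

lemma integrableOn_smul_coe {ψ : ℝ → ℝ}
    (hψ : MemLp (fun s => ψ s * κ.μ s) 2 κ.νMeasure) (ξ : Lp X 2 κ.νMeasure) : IntegrableOn (fun s => ψ s • ξ s) κ.Ω := by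
  have h : Integrable ((fun s => ψ s * κ.μ s) • (ξ : ℝ → X)) κ.νMeasure :=
    memLp_one_iff_integrable.1 ((Lp.memLp ξ).smul hψ)
  rw [κ.integrable_νMeasure_iff] at h
  refine h.congr ?_
  filter_upwards [ae_restrict_mem κ.measurableSet_Ω] with s hs
  rw [Pi.smul_apply', smul_smul]
  congr 1
  linear_combination ψ s * κ.ν_mul_μ hs

variable [CompleteSpace X]

/-- The weighted integral `ξ ↦ ∫_Ω ψ ξ` as a bounded operator, for `ψ μ ∈ L²_ν(Ω)`. -/
def moment {ψ : ℝ → ℝ} (hψ : MemLp (fun s => ψ s * κ.μ s) 2 κ.νMeasure) :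
    Lp X 2 κ.νMeasure →L[ℝ] X :=
  ContinuousLinearMap.adjoint (constLp hψ)

variable {ψ : ℝ → ℝ} (hψ : MemLp (fun s => ψ s * κ.μ s) 2 κ.νMeasure)

/-- The weight `ν` of the inner product cancels the factor `μ` in `ψ μ`. -/
lemma moment_apply (ξ : Lp X 2 κ.νMeasure) : moment hψ ξ = ∫ s in κ.Ω, ψ s • ξ s := by
  refine ext_inner_left ℝ fun x => ?_
  rw [moment, ContinuousLinearMap.adjoint_inner_right, L2.inner_def, κ.integral_νMeasure,
    ← integral_inner (integrableOn_smul_coe hψ ξ)]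
  refine integral_congr_ae ?_
  filter_upwards [ae_restrict_mem κ.measurableSet_Ω, coeFn_constLp hψ x] with s hs h
  rw [h, real_inner_smul_left, real_inner_smul_right, smul_eq_mul]
  linear_combination ψ s * ⟪x, ξ s⟫ * κ.ν_mul_μ hs

lemma moment_constLp {a : ℝ → ℝ} (ha : MemLp a 2 κ.νMeasure) (x : X) :
    moment hψ (constLp ha x) = (∫ s in κ.Ω, ψ s * a s) • x := by
  rw [moment_apply, ← integral_smul_const]
  refine integral_congr_ae ?_
  filter_upwards [coeFn_constLp ha x] with s h
  rw [h, smul_smul]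

end Moments

end

section

/-! ### The resolvent of the derivative -/

/-- The one-sided exponential kernel `e^{l x} 1_{x < 0}`. -/
def expKer (l x : ℝ) : ℝ := (Iio (0 : ℝ)).indicator (fun y => Real.exp (l * y)) x

lemma expKer_of_neg (l : ℝ) {x : ℝ} (hx : x < 0) : expKer l x = Real.exp (l * x) :=
  indicator_of_mem (mem_Iio.2 hx) _

lemma expKer_of_nonneg (l : ℝ) {x : ℝ} (hx : 0 ≤ x) : expKer l x = 0 :=
  indicator_of_notMem (notMem_Iio.2 hx) _

lemma expKer_nonneg (l x : ℝ) : 0 ≤ expKer l x :=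
  indicator_nonneg (fun _ _ => (Real.exp_pos _).le) x

lemma expKer_le_one {l : ℝ} (hl : 0 ≤ l) (x : ℝ) : expKer l x ≤ 1 := by
  rcases lt_or_ge x 0 with h | h
  · rw [expKer_of_neg l h]
    exact Real.exp_le_one_iff.2 (mul_nonpos_of_nonneg_of_nonpos hl h.le)
  · rw [expKer_of_nonneg l h]; exact zero_le_one

lemma expKer_mul_expKer (a b x : ℝ) : expKer a x * expKer b x = expKer (a + b) x := by
  rcases lt_or_ge x 0 with h | h
  · rw [expKer_of_neg _ h, expKer_of_neg _ h, expKer_of_neg _ h, ← Real.exp_add, add_mul]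
  · simp [expKer_of_nonneg _ h]

lemma measurable_expKer (l : ℝ) : Measurable (expKer l) :=
  Measurable.indicator (by fun_prop) measurableSet_Iio

lemma integrable_expKer {l : ℝ} (hl : 0 < l) : Integrable (expKer l) :=
  ((integrableOn_exp_mul_Iic hl 0).mono_set Iio_subset_Iic_self).integrable_indicator
    measurableSet_Iio

lemma integral_expKer {l : ℝ} (hl : 0 < l) : ∫ x, expKer l x = l⁻¹ := by
  simp only [expKer]
  rw [integral_indicator measurableSet_Iio, ← integral_Iic_eq_integral_Iio,
    integral_exp_mul_Iic hl, mul_zero, Real.exp_zero, one_div]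

lemma lintegral_expKer {l : ℝ} (hl : 0 < l) :
    ∫⁻ x, ENNReal.ofReal (expKer l x) = ENNReal.ofReal l⁻¹ := by
  rw [← integral_expKer hl, ofReal_integral_eq_lintegral_ofReal (integrable_expKer hl)
    (ae_of_all _ (expKer_nonneg l))]

lemma continuousAt_expKer (l : ℝ) {x : ℝ} (hx : x ≠ 0) : ContinuousAt (expKer l) x := by
  rcases lt_or_gt_of_ne hx with h | h
  · have : ContinuousAt (fun y => Real.exp (l * y)) x := by fun_prop
    refine this.congr ?_
    filter_upwards [Iio_mem_nhds h] with y hy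
    exact (expKer_of_neg l hy).symm
  · refine (continuousAt_const (y := (0 : ℝ))).congr ?_
    filter_upwards [Ioi_mem_nhds h] with y hy
    exact (expKer_of_nonneg l (le_of_lt hy)).symm

section ExpConv

variable {X : Type*} [NormedAddCommGroup X] [NormedSpace ℝ X]

/-- `τ ↦ ∫_τ^ℓ e^{-l (s - τ)} k(s) ds`, the solution of `l ξ - Dξ = k`, `ξ(ℓ) = 0` on `Ω`. -/
def expConv (Ω : Set ℝ) (l : ℝ) (k : ℝ → X) (τ : ℝ) : X :=
  ∫ s, expKer l (τ - s) • Ω.indicator k s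

variable {Ω : Set ℝ} {l : ℝ} {k : ℝ → X}

lemma aestronglyMeasurable_expConv_integrand (hk : Integrable (Ω.indicator k)) (τ : ℝ) :
    AEStronglyMeasurable (fun s => expKer l (τ - s) • Ω.indicator k s) :=
  ((measurable_expKer l).comp (measurable_const.sub measurable_id)).aestronglyMeasurable.smul
    hk.aestronglyMeasurable

lemma norm_expConv_integrand_le (hl : 0 ≤ l) (τ s : ℝ) :
    ‖expKer l (τ - s) • Ω.indicator k s‖ ≤ ‖Ω.indicator k s‖ := by
  rw [norm_smul, Real.norm_of_nonneg (expKer_nonneg _ _)]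
  exact mul_le_of_le_one_left (norm_nonneg _) (expKer_le_one hl _)

lemma continuous_expConv (hl : 0 ≤ l) (hk : Integrable (Ω.indicator k)) :
    Continuous (expConv Ω l k) := by
  rw [continuous_iff_continuousAt]
  intro τ
  refine continuousAt_of_dominated (bound := fun s => ‖Ω.indicator k s‖)
    (Eventually.of_forall fun τ => aestronglyMeasurable_expConv_integrand hk τ)
    (Eventually.of_forall fun τ => ae_of_all _ fun s => norm_expConv_integrand_le hl τ s)
    hk.norm ?_
  -- The kernel jumps only at `s = τ`, a null set.
  filter_upwards [Measure.ae_ne volume τ] with s hs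
  have h : ContinuousAt (fun t => expKer l (t - s)) τ :=
    ContinuousAt.comp (f := fun t => t - s) (continuousAt_expKer l (sub_ne_zero.2 hs.symm))
      (by fun_prop)
  exact h.smul continuousAt_const

instance (ℓ : EReal) : (leftOf ℓ).IsCountablyGenerated := by unfold leftOf; infer_instance

/-- For fixed `s` in the interval the integrand vanishes once `τ` passes `s`; dominated convergence
does the rest. -/
lemma tendsto_expConv_leftOf {ℓ : EReal} (hl : 0 ≤ l) (hk : Integrable ((interval ℓ).indicator k)) :
    Tendsto (expConv (interval ℓ) l k) (leftOf ℓ) (𝓝 0) := by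
  rw [← integral_zero ℝ X (μ := volume)]
  refine tendsto_integral_filter_of_dominated_convergence
    (fun s => ‖(interval ℓ).indicator k s‖)
    (Eventually.of_forall fun τ => aestronglyMeasurable_expConv_integrand hk τ)
    (Eventually.of_forall fun τ => ae_of_all _ fun s => norm_expConv_integrand_le hl τ s)
    hk.norm (ae_of_all _ fun s => ?_)
  refine tendsto_const_nhds.congr' ?_
  by_cases hs : s ∈ interval ℓ
  · have : Ioo (s : EReal) ℓ ∈ 𝓝[<] ℓ := Ioo_mem_nhdsLT hs.2
    filter_upwards [preimage_mem_comap this] with τ hτ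
    rw [expKer_of_nonneg l (sub_nonneg.2 (EReal.coe_lt_coe_iff.1 hτ.1).le), zero_smul]
  · simp [indicator_of_notMem hs]

lemma integrable_expConv_prod (hl : 0 < l) (hk : Integrable (Ω.indicator k)) {w : ℝ → ℝ}
    (hw : Measurable w) {C : ℝ} (hC : ∀ τ, |w τ| ≤ C) :
    Integrable (fun p : ℝ × ℝ => (w p.1 * expKer l (p.1 - p.2)) • Ω.indicator k p.2)
      (volume.prod volume) := by
  have h := Integrable.convolution_integrand ((ContinuousLinearMap.lsmul ℝ ℝ).flip :
    X →L[ℝ] ℝ →L[ℝ] X) hk (integrable_expKer hl)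
  have h2 := h.bdd_smul (φ := fun p : ℝ × ℝ => w p.1) C
    (hw.comp measurable_fst).aestronglyMeasurable (ae_of_all _ fun p => hC p.1)
  refine h2.congr (ae_of_all _ fun p => ?_)
  simp [mul_smul]

/-- Fubini moves the convolution onto the scalar weight. It is used with test functions, their
derivatives, and the indicator of `Ω`. -/
lemma integral_smul_expConv [CompleteSpace X] (hl : 0 < l) (hk : Integrable (Ω.indicator k)) {w : ℝ → ℝ}
    (hw : Measurable w) {C : ℝ} (hC : ∀ τ, |w τ| ≤ C) :
    ∫ τ, w τ • expConv Ω l k τ = ∫ s, (∫ τ, w τ * expKer l (τ - s)) • Ω.indicator k s := by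
  have h := integral_integral_swap
    (f := fun τ s => (w τ * expKer l (τ - s)) • Ω.indicator k s) (integrable_expConv_prod hl hk hw hC)
  simp only [integral_smul_const] at h
  rw [← h]
  refine integral_congr_ae (ae_of_all _ fun τ => ?_)
  simp only [expConv, mul_smul, integral_smul]

end ExpConv

section Bound

variable {κ : Kernel} {X : Type*} [NormedAddCommGroup X] [NormedSpace ℝ X]

/-- Cauchy–Schwarz after splitting `e^{lx}` into `e^{(l+δ/2)x/2} e^{(l-δ/2)x/2}` for `x < 0`; the
square of the first factor has integral `(l + δ/2)⁻¹`. -/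
lemma enorm_expConv_rpow_le {l δ : ℝ} (hβ : 0 < l + δ / 2) {k : ℝ → X} {Ω : Set ℝ}
    (hk : AEStronglyMeasurable (Ω.indicator k) volume) (τ : ℝ) :
    ‖expConv Ω l k τ‖ₑ ^ (2 : ℝ) ≤ ENNReal.ofReal (l + δ / 2)⁻¹ *
      ∫⁻ s, ENNReal.ofReal (expKer (l - δ / 2) (τ - s)) * ‖Ω.indicator k s‖ₑ ^ (2 : ℝ) := by
  set p : ℝ → ℝ≥0∞ := fun s => ENNReal.ofReal (expKer ((l + δ / 2) / 2) (τ - s))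
  set q : ℝ → ℝ≥0∞ := fun s =>
    ENNReal.ofReal (expKer ((l - δ / 2) / 2) (τ - s)) * ‖Ω.indicator k s‖ₑ
  have hmeas : ∀ a, Measurable fun s => ENNReal.ofReal (expKer a (τ - s)) := fun a =>
    ((measurable_expKer a).comp (measurable_const.sub measurable_id)).ennreal_ofReal
  have hsq : ∀ a s, ENNReal.ofReal (expKer (a / 2) (τ - s)) ^ (2 : ℝ) =
      ENNReal.ofReal (expKer a (τ - s)) := fun a s => by
    rw [ENNReal.rpow_two, sq, ← ENNReal.ofReal_mul (expKer_nonneg _ _), expKer_mul_expKer,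
      add_halves]
  have h1 : ‖expConv Ω l k τ‖ₑ ≤ ∫⁻ s, (p * q) s := by
    refine (enorm_integral_le_lintegral_enorm _).trans (lintegral_mono fun s => ?_)
    simp only [Pi.mul_apply, p, q]
    rw [← mul_assoc, ← ENNReal.ofReal_mul (expKer_nonneg _ _), expKer_mul_expKer, enorm_smul,
      Real.enorm_of_nonneg (expKer_nonneg _ _)]
    ring_nf
    exact le_rfl
  have h2 := h1.trans (ENNReal.lintegral_mul_le_Lp_mul_Lq volume Real.HolderConjugate.two_two
    (hmeas _).aemeasurable ((hmeas _).aemeasurable.mul hk.enorm))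
  have h3 := ENNReal.rpow_le_rpow h2 (zero_le_two (α := ℝ))
  rw [ENNReal.mul_rpow_of_nonneg _ _ zero_le_two, ← ENNReal.rpow_mul, ← ENNReal.rpow_mul] at h3
  norm_num at h3
  have hp : ∫⁻ s, p s ^ (2 : ℝ) = ENNReal.ofReal (l + δ / 2)⁻¹ := by
    simp only [p, hsq]
    rw [lintegral_sub_left_eq_self (fun x => ENNReal.ofReal (expKer (l + δ / 2) x)) τ,
      lintegral_expKer hβ]
  have hq : ∫⁻ s, q s ^ (2 : ℝ) =
      ∫⁻ s, ENNReal.ofReal (expKer (l - δ / 2) (τ - s)) * ‖Ω.indicator k s‖ₑ ^ (2 : ℝ) := by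
    refine lintegral_congr fun s => ?_
    simp only [q]
    rw [ENNReal.mul_rpow_of_nonneg _ _ zero_le_two, hsq]
  simp only [← ENNReal.rpow_two] at h3
  rwa [hp, hq] at h3

/-- The resolvent bound for the derivative in `L²_ν(Ω; X)`. -/
lemma eLpNorm_expConv_le {l δ : ℝ} (hl : 0 ≤ l) (hβ : 0 < l + δ / 2)
    (hdec : ∀ s ∈ κ.Ω, ∀ t ∈ κ.Ω, s ≤ t → Real.exp (δ * (t - s)) * κ.ν s ≤ κ.ν t)
    {k : ℝ → X} (hk : IntegrableOn k κ.Ω) :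
    eLpNorm (expConv κ.Ω l k) 2 κ.νMeasure ≤
      ENNReal.ofReal (l + δ / 2)⁻¹ * eLpNorm k 2 κ.νMeasure := by
  set β := l + δ / 2
  set K := κ.Ω.indicator k
  have hK : Integrable K := hk.integrable_indicator κ.measurableSet_Ω
  have hsq : ∀ f : ℝ → X, AEStronglyMeasurable f (volume.restrict κ.Ω) →
      eLpNorm f 2 κ.νMeasure ^ (2 : ℝ) =
        ∫⁻ s in κ.Ω, ENNReal.ofReal (κ.ν s) * ‖f s‖ₑ ^ (2 : ℝ) := by
    intro f hf
    rw [← κ.lintegral_νMeasure (hf.enorm.pow_const _)]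
    exact eLpNorm_nnreal_pow_eq_lintegral (p := 2) two_ne_zero
  have hmain : ∫⁻ τ in κ.Ω, ENNReal.ofReal (κ.ν τ) * ‖expConv κ.Ω l k τ‖ₑ ^ (2 : ℝ) ≤
      ENNReal.ofReal β⁻¹ * (ENNReal.ofReal β⁻¹ *
        ∫⁻ s in κ.Ω, ENNReal.ofReal (κ.ν s) * ‖k s‖ₑ ^ (2 : ℝ)) := by
    calc _ ≤ ∫⁻ τ in κ.Ω, ENNReal.ofReal β⁻¹ * ∫⁻ s, ENNReal.ofReal (κ.ν τ) *
            (ENNReal.ofReal (expKer (l - δ / 2) (τ - s)) * ‖K s‖ₑ ^ (2 : ℝ)) := by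
          refine lintegral_mono fun τ => ?_
          rw [lintegral_const_mul' _ _ ENNReal.ofReal_ne_top, mul_left_comm]
          gcongr
          exact enorm_expConv_rpow_le hβ hK.aestronglyMeasurable τ
      _ = ENNReal.ofReal β⁻¹ * ∫⁻ s, ∫⁻ τ in κ.Ω, ENNReal.ofReal (κ.ν τ) *
            (ENNReal.ofReal (expKer (l - δ / 2) (τ - s)) * ‖K s‖ₑ ^ (2 : ℝ)) := by
          rw [lintegral_const_mul' _ _ ENNReal.ofReal_ne_top, lintegral_lintegral_swap]
          refine κ.aemeasurable_ofReal_ν.comp_fst.mul (AEMeasurable.mul ?_ ?_)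
          · exact ((measurable_expKer _).comp
              (measurable_fst.sub measurable_snd)).ennreal_ofReal.aemeasurable
          · exact (hK.aestronglyMeasurable.enorm.pow_const _).comp_snd
      _ ≤ ENNReal.ofReal β⁻¹ * ∫⁻ s, κ.Ω.indicator (fun s => ENNReal.ofReal β⁻¹ *
            (ENNReal.ofReal (κ.ν s) * ‖k s‖ₑ ^ (2 : ℝ))) s := by
          gcongr with s
          by_cases hs : s ∈ κ.Ω
          · have h1 : ∀ τ ∈ κ.Ω, ENNReal.ofReal (κ.ν τ) *
                (ENNReal.ofReal (expKer (l - δ / 2) (τ - s)) * ‖K s‖ₑ ^ (2 : ℝ)) ≤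
                ENNReal.ofReal (expKer β (τ - s)) *
                  (ENNReal.ofReal (κ.ν s) * ‖k s‖ₑ ^ (2 : ℝ)) := by
              intro τ hτ
              rw [← mul_assoc, ← mul_assoc, ← ENNReal.ofReal_mul (κ.ν_pos hτ).le,
                ← ENNReal.ofReal_mul (expKer_nonneg _ _)]
              simp only [K, indicator_of_mem hs]
              refine mul_le_mul' (ENNReal.ofReal_le_ofReal ?_) le_rfl
              rcases lt_or_ge (τ - s) 0 with h | h
              -- For `τ < s` the decay gives `ν(τ) ≤ e^{δ(τ-s)} ν(s)`, which raises the exponent `l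
              -- - δ/2` to `β = l + δ/2`; integrating in `τ` yields the second factor `β⁻¹`.
              · have h2 := hdec τ hτ s hs (by linarith)
                have h3 : expKer β (τ - s) =
                    expKer (l - δ / 2) (τ - s) * Real.exp (δ * (τ - s)) := by
                  rw [← expKer_of_neg δ h, expKer_mul_expKer]
                  congr 1; simp only [β]; ring
                have h4 : κ.ν τ ≤ Real.exp (δ * (τ - s)) * κ.ν s := by
                  have h5 : Real.exp (δ * (τ - s)) * Real.exp (δ * (s - τ)) = 1 := by
                    rw [← Real.exp_add, ← mul_add]; simp
                  calc κ.ν τ = Real.exp (δ * (τ - s)) * (Real.exp (δ * (s - τ)) * κ.ν τ) := by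
                        rw [← mul_assoc, h5, one_mul]
                    _ ≤ _ := by gcongr
                rw [h3, mul_assoc, mul_comm (κ.ν τ)]
                exact mul_le_mul_of_nonneg_left h4 (expKer_nonneg _ _)
              · simp [expKer_of_nonneg _ h]
            rw [indicator_of_mem hs]
            refine (setLIntegral_mono' κ.measurableSet_Ω h1).trans ?_
            refine (setLIntegral_le_lintegral _ _).trans ?_
            have hm : Measurable fun τ => ENNReal.ofReal (expKer β (τ - s)) :=
              ((measurable_expKer β).comp (measurable_id.sub measurable_const)).ennreal_ofReal
            rw [lintegral_mul_const _ hm,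
              lintegral_sub_right_eq_self (fun x => ENNReal.ofReal (expKer β x)) s,
              lintegral_expKer hβ]
          · simp [K, indicator_of_notMem hs]
      _ = _ := by
          rw [lintegral_indicator κ.measurableSet_Ω,
            lintegral_const_mul' _ _ ENNReal.ofReal_ne_top]
  rw [← ENNReal.rpow_le_rpow_iff (zero_lt_two (α := ℝ)),
    ENNReal.mul_rpow_of_nonneg _ _ zero_le_two,
    hsq _ (continuous_expConv hl hK).aestronglyMeasurable, hsq _ hk.aestronglyMeasurable]
  refine hmain.trans (le_of_eq ?_)
  rw [ENNReal.rpow_two, sq, mul_assoc]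

end Bound

end

section

/-! ### Weak derivatives -/

/-- Test functions on `Ω`. -/
structure IsTestFun (Ω : Set ℝ) (φ : ℝ → ℝ) : Prop where
  contDiff : ContDiff ℝ (⊤ : ℕ∞) φ
  compact : HasCompactSupport φ
  subset : tsupport φ ⊆ Ω

namespace IsTestFun

variable {Ω : Set ℝ} {φ ψ : ℝ → ℝ}

lemma eq_zero (h : IsTestFun Ω φ) {x : ℝ} (hx : x ∉ Ω) : φ x = 0 :=
  image_eq_zero_of_notMem_tsupport fun hx' => hx (h.subset hx')

lemma exists_bound (h : IsTestFun Ω φ) : ∃ C, ∀ x, |φ x| ≤ C :=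
  h.compact.exists_bound_of_continuous h.contDiff.continuous

lemma hasDerivAt (h : IsTestFun Ω φ) (x : ℝ) : HasDerivAt φ (deriv φ x) x :=
  ((contDiff_infty_iff_deriv.1 h.contDiff).1 x).hasDerivAt

lemma deriv (h : IsTestFun Ω φ) : IsTestFun Ω (deriv φ) :=
  ⟨(contDiff_infty_iff_deriv.1 h.contDiff).2, h.compact.deriv,
    (closure_minimal support_deriv_subset (isClosed_tsupport φ)).trans h.subset⟩

lemma integrable_smul {X : Type*} [NormedAddCommGroup X] [NormedSpace ℝ X] {μ : Measure ℝ}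
    (h : IsTestFun Ω φ) {f : ℝ → X} (hf : Integrable f μ) :
    Integrable (fun x => φ x • f x) μ := by
  obtain ⟨C, hC⟩ := h.exists_bound
  exact hf.bdd_smul C h.contDiff.continuous.aestronglyMeasurable (ae_of_all _ hC)

lemma setIntegral_smul {X : Type*} [NormedAddCommGroup X] [NormedSpace ℝ X]
    (h : IsTestFun Ω φ) (f : ℝ → X) : ∫ x in Ω, φ x • f x = ∫ x, φ x • f x :=
  setIntegral_eq_integral_of_forall_compl_eq_zero fun x hx => by rw [h.eq_zero hx, zero_smul]

lemma mul_left (h : IsTestFun Ω φ) {g : ℝ → ℝ} (hg : ContDiff ℝ (⊤ : ℕ∞) g) :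
    IsTestFun Ω (fun x => g x * φ x) :=
  ⟨hg.mul h.contDiff, h.compact.mul_left, tsupport_mul_subset_right.trans h.subset⟩

end IsTestFun

/-! ### Primitives of test functions and functions with zero weak derivative -/

section DuBoisReymond

variable {X : Type*} [NormedAddCommGroup X] [NormedSpace ℝ X]

lemma exists_isTestFun_integral_eq_one {Ω : Set ℝ} (hΩ : IsOpen Ω) (hne : Ω.Nonempty) :
    ∃ θ, IsTestFun Ω θ ∧ ∫ x, θ x = 1 := by
  obtain ⟨x, hx⟩ := hne
  obtain ⟨r, hr, hball⟩ := Metric.nhds_basis_closedBall.mem_iff.1 (hΩ.mem_nhds hx)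
  let f : ContDiffBump x := ⟨r / 2, r, half_pos hr, half_lt_self hr⟩
  exact ⟨f.normed volume, ⟨f.contDiff_normed, f.hasCompactSupport_normed, by
    rw [f.tsupport_normed_eq]; exact hball⟩, f.integral_normed⟩

/-- A test function of mean zero on an interval is the derivative of a test function. -/
lemma IsTestFun.exists_primitive {Ω : Set ℝ} (hΩ : Ω.OrdConnected) {g : ℝ → ℝ}
    (hg : IsTestFun Ω g) (h0 : ∫ x, g x = 0) : ∃ φ, IsTestFun Ω φ ∧ _root_.deriv φ = g := by
  rcases (tsupport g).eq_empty_or_nonempty with he | hne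
  · have hg0 : g = 0 := tsupport_eq_empty_iff.1 he
    exact ⟨0, hg0 ▸ hg, by rw [hg0]; exact deriv_zero⟩
  obtain ⟨a, ha⟩ := hg.compact.isCompact.exists_isLeast hne
  obtain ⟨b, hb⟩ := hg.compact.isCompact.exists_isGreatest hne
  have hcont := hg.contDiff.continuous
  -- Starting at `a - 1` keeps the whole support `[a, b]`, left endpoint included, inside `(a - 1,
  -- t]` for `t > b`.
  let φ : ℝ → ℝ := fun t => ∫ x in (a - 1)..t, g x
  have hd : ∀ t, HasDerivAt φ (g t) t := fun t =>
    (hcont.integral_hasStrictDerivAt (a - 1) t).hasDerivAt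
  have hderiv : _root_.deriv φ = g := funext fun t => (hd t).deriv
  have hφ0 : ∀ t ∉ Icc a b, φ t = 0 := by
    intro t ht
    rcases lt_or_ge t a with hta | hta
    · refine intervalIntegral.integral_zero_ae (ae_of_all _ fun x hx => ?_)
      refine image_eq_zero_of_notMem_tsupport fun hx' => ?_
      have h1 := ha.2 hx'
      rcases mem_uIoc.1 hx with h2 | h2 <;> linarith [h2.2]
    · have htb : b < t := by
        by_contra hcon
        exact ht ⟨hta, not_lt.1 hcon⟩
      rw [← h0]
      refine intervalIntegral.integral_eq_integral_of_support_subset fun x hx => ?_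
      have hx' := subset_tsupport g hx
      exact ⟨by linarith [ha.2 hx'], (hb.2 hx').trans htb.le⟩
  have hsub : tsupport φ ⊆ Icc a b :=
    closure_minimal (fun x hx => by_contra fun hx' => hx (hφ0 x hx')) isClosed_Icc
  refine ⟨φ, ⟨?_, HasCompactSupport.intro isCompact_Icc hφ0,
    hsub.trans (hΩ.out (hg.subset ha.1) (hg.subset hb.1))⟩, hderiv⟩
  rw [contDiff_infty_iff_deriv, hderiv]
  exact ⟨fun t => (hd t).differentiableAt, hg.contDiff⟩

variable [CompleteSpace X]

/-- The du Bois-Reymond lemma. -/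
lemma exists_ae_eq_const_of_isWeakDeriv_zero {Ω : Set ℝ} (hΩo : IsOpen Ω) (hΩ : Ω.OrdConnected)
    (hne : Ω.Nonempty) {f : ℝ → X} (hf : IntegrableOn f Ω)
    (h : ∀ φ, IsTestFun Ω φ → ∫ τ in Ω, deriv φ τ • f τ = 0) :
    ∃ c, f =ᵐ[volume.restrict Ω] fun _ => c := by
  obtain ⟨θ, hθ, hθ1⟩ := exists_isTestFun_integral_eq_one hΩo hne
  refine ⟨∫ τ in Ω, θ τ • f τ, ?_⟩
  set c := ∫ τ in Ω, θ τ • f τ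
  have hae := hΩo.ae_eq_zero_of_integral_contDiff_smul_eq_zero (μ := volume)
    (f := f - fun _ => c)
    (hf.locallyIntegrableOn.sub (continuous_const.locallyIntegrable.locallyIntegrableOn _)) ?_
  · rw [Filter.EventuallyEq, ae_restrict_iff' hΩo.measurableSet]
    filter_upwards [hae] with x hx hxΩ
    exact sub_eq_zero.1 (hx hxΩ)
  intro ψ hψ1 hψ2 hψ3
  have hψ : IsTestFun Ω ψ := ⟨hψ1, hψ2, hψ3⟩
  have hψi : Integrable ψ := hψ1.continuous.integrable_of_hasCompactSupport hψ2
  have hθi : Integrable θ := hθ.contDiff.continuous.integrable_of_hasCompactSupport hθ.compact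
  set m := ∫ x, ψ x
  -- Subtracting `m θ` gives mean zero, so this is the derivative of a test function.
  have hg : IsTestFun Ω (fun x => ψ x - m * θ x) :=
    ⟨hψ1.sub (contDiff_const.mul hθ.contDiff), hψ2.sub (hθ.compact.mul_left),
      (tsupport_sub _ _).trans
        (union_subset hψ3 (tsupport_mul_subset_right.trans hθ.subset))⟩
  obtain ⟨φ, hφ, hφd⟩ := hg.exists_primitive hΩ (by
    rw [integral_sub hψi (hθi.const_mul m), integral_const_mul, hθ1, mul_one, sub_self])
  have h1 := h φ hφ
  rw [hφd] at h1
  have h2 : ∫ τ in Ω, (ψ τ - m * θ τ) • f τ = (∫ τ in Ω, ψ τ • f τ) - m • c := by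
    simp only [sub_smul, mul_smul]
    rw [integral_sub (hψ.integrable_smul hf) ((hθ.integrable_smul hf).fun_smul m), integral_smul]
  rw [h2] at h1
  have hfψ : Integrable (fun x => ψ x • f x) := by
    have := hψ.integrable_smul hf
    refine (integrableOn_iff_integrable_of_support_subset ?_).1 this
    intro x hx
    by_contra hx'
    exact hx (by simp [hψ.eq_zero hx'])
  have h3 : ∫ x, ψ x • (f - fun _ : ℝ => c) x = (∫ τ in Ω, ψ τ • f τ) - m • c := by
    simp only [Pi.sub_apply, smul_sub]
    rw [integral_sub hfψ (hψi.smul_const c), integral_smul_const, hψ.setIntegral_smul]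
  rw [h3, h1]

end DuBoisReymond

section WeakDeriv

variable {X : Type*} [NormedAddCommGroup X] [NormedSpace ℝ X] {Ω : Set ℝ}

lemma IsWeakDeriv.congr {f g f' g' : ℝ → X} (h : IsWeakDeriv Ω f g)
    (hf : f =ᵐ[volume.restrict Ω] f') (hg : g =ᵐ[volume.restrict Ω] g') :
    IsWeakDeriv Ω f' g' := by
  intro φ h1 h2 h3
  have e1 : ∫ τ in Ω, deriv φ τ • f' τ = ∫ τ in Ω, deriv φ τ • f τ :=
    integral_congr_ae (hf.mono fun τ h => by simp only [h])
  have e2 : ∫ τ in Ω, φ τ • g' τ = ∫ τ in Ω, φ τ • g τ :=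
    integral_congr_ae (hg.mono fun τ h => by simp only [h])
  rw [e1, e2]
  exact h φ h1 h2 h3

lemma IsWeakDeriv.add {f g f' g' : ℝ → X} (h : IsWeakDeriv Ω f g) (h' : IsWeakDeriv Ω f' g')
    (hf : IntegrableOn f Ω) (hg : IntegrableOn g Ω) (hf' : IntegrableOn f' Ω)
    (hg' : IntegrableOn g' Ω) : IsWeakDeriv Ω (f + f') (g + g') := by
  intro φ h1 h2 h3
  have hφ : IsTestFun Ω φ := ⟨h1, h2, h3⟩
  simp only [Pi.add_apply, smul_add]
  rw [integral_add (hφ.deriv.integrable_smul hf) (hφ.deriv.integrable_smul hf'),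
    integral_add (hφ.integrable_smul hg) (hφ.integrable_smul hg'), h φ h1 h2 h3,
    h' φ h1 h2 h3, neg_add]

lemma IsWeakDeriv.const_smul {f g : ℝ → X} (h : IsWeakDeriv Ω f g) (c : ℝ) :
    IsWeakDeriv Ω (c • f) (c • g) := by
  intro φ h1 h2 h3
  simp only [Pi.smul_apply, smul_comm _ c]
  rw [integral_smul, integral_smul, h φ h1 h2 h3, smul_neg]

lemma VanishesAtEnd.congr {X : Type*} [NormedAddCommGroup X] {ℓ : EReal} {f g : ℝ → X} (h : VanishesAtEnd ℓ f)
    (hfg : f =ᵐ[volume.restrict (interval ℓ)] g) : VanishesAtEnd ℓ g := by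
  obtain ⟨F, h1, h2, h3⟩ := h
  exact ⟨F, h1, hfg.symm.trans h2, h3⟩

lemma VanishesAtEnd.add {X : Type*} [NormedAddCommGroup X] {ℓ : EReal} {f g : ℝ → X} (hf : VanishesAtEnd ℓ f)
    (hg : VanishesAtEnd ℓ g) : VanishesAtEnd ℓ (f + g) := by
  obtain ⟨F, h1, h2, h3⟩ := hf
  obtain ⟨F', h1', h2', h3'⟩ := hg
  exact ⟨F + F', h1.add h1', h2.add h2', by simpa using! h3.add h3'⟩

lemma VanishesAtEnd.const_smul {ℓ : EReal} {f : ℝ → X} (hf : VanishesAtEnd ℓ f) (c : ℝ) :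
    VanishesAtEnd ℓ (c • f) := by
  obtain ⟨F, h1, h2, h3⟩ := hf
  exact ⟨c • F, h1.const_smul c, h2.const_smul c, by simpa using! h3.const_smul c⟩

variable [CompleteSpace X]

/-- Uniqueness of the weak derivative. -/
lemma ae_eq_zero_of_isWeakDeriv {g : ℝ → X} (hΩ : IsOpen Ω) (hg : IntegrableOn g Ω)
    (h : IsWeakDeriv Ω (0 : ℝ → X) g) : g =ᵐ[volume.restrict Ω] 0 := by
  rw [Filter.EventuallyEq, ae_restrict_iff' hΩ.measurableSet]
  refine hΩ.ae_eq_zero_of_integral_contDiff_smul_eq_zero hg.locallyIntegrableOn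
    fun φ h1 h2 h3 => ?_
  have := h φ h1 h2 h3
  simp only [Pi.zero_apply, smul_zero, integral_zero, zero_eq_neg] at this
  rw [← (⟨h1, h2, h3⟩ : IsTestFun Ω φ).setIntegral_smul, this]

lemma integral_mul_expKer {l : ℝ} (w : ℝ → ℝ) (s : ℝ) :
    ∫ τ, w τ * expKer l (τ - s) = ∫ τ in Iic s, w τ * Real.exp (l * (τ - s)) := by
  rw [integral_Iic_eq_integral_Iio, ← integral_indicator measurableSet_Iio]
  refine integral_congr_ae (ae_of_all _ fun τ => ?_)
  simp only [indicator]
  split_ifs with h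
  · rw [expKer_of_neg l (sub_neg.2 h)]
  · rw [expKer_of_nonneg l (sub_nonneg.2 (not_lt.1 h)), mul_zero]

/-- The fundamental theorem on `(-∞, s]` for `e^{l(τ-s)} φ(τ)`: the jump of the kernel yields the
boundary value `φ(s)`. This is the resolvent equation in dual form. -/
lemma IsTestFun.integral_deriv_mul_expKer {φ : ℝ → ℝ} (hφ : IsTestFun Ω φ) (l s : ℝ) :
    ∫ τ, _root_.deriv φ τ * expKer l (τ - s) = φ s - l * ∫ τ, φ τ * expKer l (τ - s) := by
  have hE : ContDiff ℝ (⊤ : ℕ∞) fun τ => Real.exp (l * (τ - s)) := by fun_prop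
  have hF := hφ.mul_left hE
  have h1 := hF.compact.integral_Iic_deriv_eq (hF.contDiff.of_le (by exact_mod_cast le_top)) s
  have hd : ∀ τ, _root_.deriv (fun x => Real.exp (l * (x - s)) * φ x) τ =
      _root_.deriv φ τ * Real.exp (l * (τ - s)) + l * (φ τ * Real.exp (l * (τ - s))) := by
    intro τ
    have he : HasDerivAt (fun x => Real.exp (l * (x - s))) (Real.exp (l * (τ - s)) * l) τ := by
      simpa using (((hasDerivAt_id τ).sub_const s).const_mul l).exp
    rw [(he.fun_mul (hφ.hasDerivAt τ)).deriv]
    ring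
  have hint : ∀ {χ : ℝ → ℝ}, IsTestFun Ω χ →
      Integrable (fun τ => χ τ * Real.exp (l * (τ - s))) := fun hχ =>
    (hχ.contDiff.continuous.mul hE.continuous).integrable_of_hasCompactSupport
      hχ.compact.mul_right
  simp only [hd] at h1
  rw [integral_add (hint hφ.deriv).integrableOn ((hint hφ).integrableOn.const_mul l),
    integral_const_mul, ← integral_mul_expKer, ← integral_mul_expKer] at h1
  simp only [sub_self, mul_zero, Real.exp_zero, one_mul] at h1
  linarith

/-- `ξ = expConv Ω l k` solves `l ξ - Dξ = k`. -/
lemma isWeakDeriv_expConv (hΩ : MeasurableSet Ω) {l : ℝ} (hl : 0 < l) {k : ℝ → X}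
    (hk : IntegrableOn k Ω) :
    IsWeakDeriv Ω (expConv Ω l k) (fun τ => l • expConv Ω l k τ - k τ) := by
  intro φ h1 h2 h3
  have hφ : IsTestFun Ω φ := ⟨h1, h2, h3⟩
  have hK : Integrable (Ω.indicator k) := hk.integrable_indicator hΩ
  obtain ⟨C, hC⟩ := hφ.exists_bound
  obtain ⟨C', hC'⟩ := hφ.deriv.exists_bound
  have hcont := continuous_expConv hl.le hK
  have hi1 : Integrable (fun τ => φ τ • expConv Ω l k τ) :=
    (h1.continuous.smul hcont).integrable_of_hasCompactSupport h2.smul_right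
  have e1 : ∫ τ in Ω, φ τ • (l • expConv Ω l k τ - k τ) =
      l • (∫ τ, φ τ • expConv Ω l k τ) - ∫ τ, φ τ • Ω.indicator k τ := by
    rw [← integral_smul, ← integral_sub (hi1.fun_smul l) (hφ.integrable_smul hK),
      ← setIntegral_eq_integral_of_forall_compl_eq_zero (s := Ω)
        (f := fun τ => l • φ τ • expConv Ω l k τ - φ τ • Ω.indicator k τ)
        (fun x hx => by simp [hφ.eq_zero hx])]
    refine setIntegral_congr_fun hΩ fun τ hτ => ?_
    simp only [indicator_of_mem hτ, smul_sub, smul_comm l]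
  rw [e1, hφ.deriv.setIntegral_smul, integral_smul_expConv hl hK
    hφ.deriv.contDiff.continuous.measurable hC', integral_smul_expConv hl hK
    h1.continuous.measurable hC, ← integral_smul]
  simp only [hφ.integral_deriv_mul_expKer, sub_smul, mul_smul]
  have hi2 : Integrable (fun s => (∫ τ, φ τ * expKer l (τ - s)) • Ω.indicator k s) := by
    have := (integrable_expConv_prod hl hK h1.continuous.measurable hC).integral_prod_right
    simpa only [integral_smul_const] using this
  rw [integral_sub (hφ.integrable_smul hK) (hi2.fun_smul l), neg_sub]

end WeakDeriv

/-! ### Boundary value, uniqueness and total integral of the solution of `l ξ - Dξ = k` -/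

section Resolvent

variable {κ : Kernel} {X : Type*} [NormedAddCommGroup X] [NormedSpace ℝ X]

lemma vanishesAtEnd_expConv {l : ℝ} (hl : 0 ≤ l) {k : ℝ → X} (hk : IntegrableOn k κ.Ω) :
    VanishesAtEnd κ.ℓ (expConv κ.Ω l k) :=
  have hK := hk.integrable_indicator κ.measurableSet_Ω
  ⟨expConv κ.Ω l k, (continuous_expConv hl hK).continuousOn, EventuallyEq.rfl,
    tendsto_expConv_leftOf hl hK⟩

lemma Kernel.ordConnected_Ω (κ : Kernel) : κ.Ω.OrdConnected :=
  ⟨fun _ hs _ ht => κ.Icc_subset hs ht⟩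

lemma Kernel.leftOf_neBot (κ : Kernel) : (leftOf κ.ℓ).NeBot := by
  refine comap_neBot fun t ht => ?_
  obtain ⟨a, ha, hat⟩ := (mem_nhdsLT_iff_exists_Ioo_subset' κ.ℓ_pos).1 ht
  obtain ⟨r, h1, h2⟩ := EReal.lt_iff_exists_real_btwn.1 ha
  exact ⟨r, hat ⟨h1, h2⟩⟩

lemma Kernel.Ω_mem_leftOf (κ : Kernel) : κ.Ω ∈ leftOf κ.ℓ := by
  filter_upwards [preimage_mem_comap (Ioo_mem_nhdsLT κ.ℓ_pos)] with s hs
  exact ⟨by exact_mod_cast hs.1, hs.2⟩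

variable [CompleteSpace X]

/-- `l - P` is injective. -/
lemma ae_eq_zero_of_isWeakDeriv_smul_self {l : ℝ} (hl : 0 ≤ l) {f : ℝ → X}
    (hf : IntegrableOn f κ.Ω) (h : IsWeakDeriv κ.Ω f (l • f)) (h0 : VanishesAtEnd κ.ℓ f) :
    f =ᵐ[volume.restrict κ.Ω] 0 := by
  have hE : ContDiff ℝ (⊤ : ℕ∞) fun τ => Real.exp (-l * τ) := by fun_prop
  have hgi : IntegrableOn (fun τ => Real.exp (-l * τ) • f τ) κ.Ω := by
    refine hf.bdd_smul (φ := fun τ => Real.exp (-l * τ)) 1 hE.continuous.aestronglyMeasurable ?_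
    filter_upwards [ae_restrict_mem κ.measurableSet_Ω] with s hs
    rw [Real.norm_of_nonneg (Real.exp_pos _).le, Real.exp_le_one_iff]
    nlinarith [κ.pos_of_mem hs]
  -- `e^{-lτ} f` has zero weak derivative, as seen by testing the equation with `e^{-lτ} φ`; so it
  -- is a constant `c`.
  obtain ⟨c, hc⟩ := exists_ae_eq_const_of_isWeakDeriv_zero κ.isOpen_Ω κ.ordConnected_Ω
    κ.nonempty_Ω hgi fun φ hφ => by
      have hψ := hφ.mul_left hE
      have h1 := h _ hψ.contDiff hψ.compact hψ.subset
      have hd : ∀ τ, deriv (fun x => Real.exp (-l * x) * φ x) τ =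
          deriv φ τ * Real.exp (-l * τ) - l * (Real.exp (-l * τ) * φ τ) := by
        intro τ
        have he : HasDerivAt (fun x => Real.exp (-l * x)) (Real.exp (-l * τ) * -l) τ := by
          simpa using ((hasDerivAt_id τ).const_mul (-l)).exp
        rw [(he.fun_mul (hφ.hasDerivAt τ)).deriv]
        ring
      simp only [hd, sub_smul, mul_smul, Pi.smul_apply] at h1
      have hi1 := hφ.deriv.integrable_smul hgi
      have hi2 := hψ.integrable_smul hf
      simp only [mul_smul] at hi2
      rw [integral_sub hi1 (hi2.fun_smul l), integral_smul] at h1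
      simp only [smul_comm _ l] at h1
      rw [integral_smul] at h1
      simpa using h1
  have hfc : f =ᵐ[volume.restrict κ.Ω] fun τ => Real.exp (l * τ) • c := by
    filter_upwards [hc] with τ hτ
    rw [← hτ, smul_smul, ← Real.exp_add]
    simp
  obtain ⟨F, hF, hfF, hlim⟩ := h0
  have heq : EqOn F (fun τ => Real.exp (l * τ) • c) κ.Ω :=
    Measure.eqOn_open_of_ae_eq (hfF.symm.trans hfc) κ.isOpen_Ω hF (by fun_prop)
  have := κ.leftOf_neBot
  -- The continuous representative is `e^{lτ} c`, of norm at least `‖c‖` since `l ≥ 0`, yet it tends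
  -- to `0` at `ℓ`.
  have hc0 : ‖c‖ ≤ 0 := by
    refine ge_of_tendsto (by simpa using hlim.norm) ?_
    filter_upwards [κ.Ω_mem_leftOf] with τ hτ
    rw [heq hτ, norm_smul, Real.norm_of_nonneg (Real.exp_pos _).le]
    exact le_mul_of_one_le_left (norm_nonneg _)
      (Real.one_le_exp (mul_nonneg hl (κ.pos_of_mem hτ).le))
  filter_upwards [hfc] with τ hτ
  rw [hτ, norm_le_zero_iff.1 hc0, smul_zero, Pi.zero_apply]

/-- After Fubini the inner integral is `∫_0^s e^{l(τ-s)} dτ`, because for `τ ≤ s` with `s` in `Ω`,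
membership of `τ` in `Ω` just means `τ > 0`. -/
lemma integral_expConv {l : ℝ} (hl : 0 < l) {k : ℝ → X} (hk : IntegrableOn k κ.Ω) :
    ∫ τ in κ.Ω, expConv κ.Ω l k τ = ∫ s in κ.Ω, ((1 - Real.exp (-l * s)) / l) • k s := by
  have hK := hk.integrable_indicator κ.measurableSet_Ω
  have h := integral_smul_expConv hl hK (w := κ.Ω.indicator fun _ => 1)
    (measurable_const.indicator κ.measurableSet_Ω) (C := 1) (fun τ => by
      by_cases hτ : τ ∈ κ.Ω <;> simp [hτ])
  have h1 : ∫ τ, κ.Ω.indicator (fun _ => (1 : ℝ)) τ • expConv κ.Ω l k τ =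
      ∫ τ in κ.Ω, expConv κ.Ω l k τ := by
    rw [← integral_indicator κ.measurableSet_Ω]
    refine integral_congr_ae (ae_of_all _ fun τ => ?_)
    by_cases hτ : τ ∈ κ.Ω <;> simp [hτ]
  rw [← h1, h, ← integral_indicator κ.measurableSet_Ω]
  refine integral_congr_ae (ae_of_all _ fun s => ?_)
  by_cases hs : s ∈ κ.Ω
  · simp only [indicator_of_mem hs]
    congr 1
    have hs0 := κ.pos_of_mem hs
    have h2 : ∀ τ ∈ Iic s, κ.Ω.indicator (fun _ => (1 : ℝ)) τ * Real.exp (l * (τ - s)) =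
        (Ioi 0).indicator (fun τ => Real.exp (l * (τ - s))) τ := by
      intro τ hτ
      by_cases h0 : 0 < τ
      · simp [indicator_of_mem (κ.mem_of_le h0 hτ hs), h0]
      · have : τ ∉ κ.Ω := fun h => h0 h.1
        simp [this, h0]
    rw [integral_mul_expKer, setIntegral_congr_fun measurableSet_Iic h2,
      setIntegral_indicator measurableSet_Ioi, inter_comm, Ioi_inter_Iic,
      ← intervalIntegral.integral_of_le hs0.le]
    have hd : ∀ τ ∈ uIcc 0 s, HasDerivAt (fun τ => Real.exp (l * (τ - s)) / l)
        (Real.exp (l * (τ - s))) τ := by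
      intro τ _
      have := ((((hasDerivAt_id τ).sub_const s).const_mul l).exp).div_const l
      simpa [hl.ne'] using! this
    rw [intervalIntegral.integral_eq_sub_of_hasDerivAt hd
      (Continuous.intervalIntegrable (by fun_prop) _ _)]
    simp [sub_div]
  · simp [indicator_of_notMem hs]

end Resolvent

end

section

/-! ### The operator `P` -/

/-- The kernel satisfies `μ' + δ μ ≤ 0`, in integrated form. -/
def Kernel.Decays (κ : Kernel) (δ : ℝ) : Prop :=
  ∀ s ∈ κ.Ω, ∀ t ∈ κ.Ω, s ≤ t → Real.exp (δ * (t - s)) * κ.ν s ≤ κ.ν t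

/-- The weight `(1 - e^{-l s}) / l`. -/
def expWeight (l s : ℝ) : ℝ := (1 - Real.exp (-l * s)) / l

lemma continuous_expWeight (l : ℝ) : Continuous (expWeight l) := by
  unfold expWeight; fun_prop

lemma expWeight_pos {l s : ℝ} (hl : 0 < l) (hs : 0 < s) : 0 < expWeight l s := by
  refine div_pos (sub_pos.2 ?_) hl
  rw [Real.exp_lt_one_iff]
  nlinarith

lemma Kernel.memLp_expWeight (κ : Kernel) {l : ℝ} (hl : 0 < l) :
    MemLp (fun s => expWeight l s * κ.μ s) 2 κ.νMeasure := by
  refine κ.memLp_mul_μ (continuous_expWeight l) (C := 1 / l) fun s hs => ?_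
  rw [abs_of_pos (expWeight_pos hl (κ.pos_of_mem hs))]
  exact div_le_div_of_nonneg_right (by linarith [Real.exp_pos (-l * s)]) hl.le

lemma Kernel.memLp_one_mul (κ : Kernel) : MemLp (fun s => 1 * κ.μ s) 2 κ.νMeasure :=
  κ.memLp_mul_μ (ψ := fun _ => 1) continuous_const (C := 1) (by simp)

/-- This constant makes the resolvent equation of `𝔸` solvable for `v`, and for `l = 1` it is the
damping coefficient of `v` in the Lyapunov estimate. -/
lemma Kernel.integral_expWeight_mul_pos (κ : Kernel) {l : ℝ} (hl : 0 < l) :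
    0 < ∫ s in κ.Ω, expWeight l s * (1 * κ.μ s) := by
  have hpos : ∀ s ∈ κ.Ω, 0 < expWeight l s * (1 * κ.μ s) := fun s hs =>
    mul_pos (expWeight_pos hl (κ.pos_of_mem hs)) (by rw [one_mul]; exact κ.pos s hs)
  have hint : IntegrableOn (fun s => expWeight l s * (1 * κ.μ s)) κ.Ω := by
    simpa only [one_mul] using κ.integrableOn_of_memLp (κ.memLp_expWeight hl)
  rw [setIntegral_pos_iff_support_of_nonneg_ae ?_ hint]
  · exact (κ.isOpen_Ω.measure_pos volume κ.nonempty_Ω).trans_le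
      (measure_mono fun s hs => ⟨(hpos s hs).ne', hs⟩)
  · filter_upwards [ae_restrict_mem κ.measurableSet_Ω] with s hs
    exact (hpos s hs).le

variable {H : Type u} [NormedAddCommGroup H] [InnerProductSpace ℝ H] [CompleteSpace H]
  {A : PosOperator H} {κ : Kernel}

lemma Kernel.ae_of_νMeasure {p : ℝ → Prop} (h : ∀ᵐ s ∂κ.νMeasure, p s) :
    ∀ᵐ s ∂volume.restrict κ.Ω, p s := by
  rwa [κ.ae_νMeasure] at h

lemma Kernel.ae_to_νMeasure {p : ℝ → Prop} (h : ∀ᵐ s ∂volume.restrict κ.Ω, p s) :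
    ∀ᵐ s ∂κ.νMeasure, p s := by
  rwa [κ.ae_νMeasure]

lemma PGraph.add {ξ η ξ' η' : StateSpace A κ} (h : PGraph A κ ξ η) (h' : PGraph A κ ξ' η') :
    PGraph A κ (ξ + ξ') (η + η') :=
  have e := fun f g : StateSpace A κ => (Kernel.ae_of_νMeasure (Lp.coeFn_add f g).symm)
  ⟨(h.1.add h'.1 (κ.integrableOn_coe _) (κ.integrableOn_coe _) (κ.integrableOn_coe _)
    (κ.integrableOn_coe _)).congr (e ξ ξ') (e η η'), (h.2.add h'.2).congr (e ξ ξ')⟩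

lemma PGraph.const_smul {ξ η : StateSpace A κ} (h : PGraph A κ ξ η) (c : ℝ) :
    PGraph A κ (c • ξ) (c • η) :=
  have e := fun f : StateSpace A κ => (Kernel.ae_of_νMeasure (Lp.coeFn_smul c f).symm)
  ⟨(h.1.const_smul c).congr (e ξ) (e η), (h.2.const_smul c).congr (e ξ)⟩

lemma PGraph.sub {ξ η ξ' η' : StateSpace A κ} (h : PGraph A κ ξ η) (h' : PGraph A κ ξ' η') :
    PGraph A κ (ξ - ξ') (η - η') := by
  have := h.add (h'.const_smul (-1))
  simpa [sub_eq_add_neg] using this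

lemma PGraph.zero : PGraph A κ 0 0 := by
  have e : ⇑(0 : StateSpace A κ) =ᵐ[volume.restrict κ.Ω] 0 :=
    Kernel.ae_of_νMeasure (Lp.coeFn_zero A.V 2 κ.νMeasure)
  refine ⟨IsWeakDeriv.congr (f := 0) (g := 0) (fun φ _ _ _ => by simp) e.symm e.symm,
    VanishesAtEnd.congr (f := 0) ⟨0, continuousOn_const, EventuallyEq.rfl, tendsto_const_nhds⟩
      e.symm⟩

lemma PGraph.eq_zero_of_zero {η : StateSpace A κ} (h : PGraph A κ 0 η) : η = 0 := by
  have e : ⇑(0 : StateSpace A κ) =ᵐ[volume.restrict κ.Ω] 0 :=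
    Kernel.ae_of_νMeasure (Lp.coeFn_zero A.V 2 κ.νMeasure)
  exact (Lp.eq_zero_iff_ae_eq_zero).2 (Kernel.ae_to_νMeasure
    (ae_eq_zero_of_isWeakDeriv κ.isOpen_Ω (κ.integrableOn_coe η) (h.1.congr e EventuallyEq.rfl)))

lemma PGraph.eq_zero_of_smul_self {l : ℝ} (hl : 0 ≤ l) {ξ : StateSpace A κ}
    (h : PGraph A κ ξ (l • ξ)) : ξ = 0 :=
  (Lp.eq_zero_iff_ae_eq_zero).2 (Kernel.ae_to_νMeasure
    (ae_eq_zero_of_isWeakDeriv_smul_self hl (κ.integrableOn_coe ξ)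
      (h.1.congr EventuallyEq.rfl (Kernel.ae_of_νMeasure (Lp.coeFn_smul l ξ))) h.2))

/-- The resolvent of `P`. -/
lemma exists_PGraph_resolvent {δ : ℝ} (hδ : 0 ≤ δ) (hκ : κ.Decays δ) {l : ℝ} (hl : 0 < l)
    (k : StateSpace A κ) :
    ∃ ξ : StateSpace A κ, PGraph A κ ξ (l • ξ - k) ∧ ξ =ᵐ[volume.restrict κ.Ω] expConv κ.Ω l k ∧
      ‖ξ‖ ≤ (l + δ / 2)⁻¹ * ‖k‖ := by
  have hk := κ.integrableOn_coe k
  have hK := hk.integrable_indicator κ.measurableSet_Ω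
  have hβ : 0 < l + δ / 2 := by positivity
  have hb := eLpNorm_expConv_le hl.le hβ hκ hk
  have hfin : ENNReal.ofReal (l + δ / 2)⁻¹ * eLpNorm k 2 κ.νMeasure < ⊤ :=
    ENNReal.mul_lt_top ENNReal.ofReal_lt_top (Lp.memLp k).2
  have hm : MemLp (expConv κ.Ω l k) 2 κ.νMeasure :=
    ⟨(continuous_expConv hl.le hK).aestronglyMeasurable, hb.trans_lt hfin⟩
  have e := Kernel.ae_of_νMeasure hm.coeFn_toLp
  refine ⟨hm.toLp, ⟨?_, ?_⟩, e, ?_⟩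
  · refine (isWeakDeriv_expConv κ.measurableSet_Ω hl hk).congr (EventuallyEq.symm e) ?_
    filter_upwards [e, Kernel.ae_of_νMeasure (Lp.coeFn_sub (l • hm.toLp) k),
      Kernel.ae_of_νMeasure (Lp.coeFn_smul l hm.toLp)] with s h1 h2 h3
    rw [h2, Pi.sub_apply, h3, Pi.smul_apply, h1]
  · exact (vanishesAtEnd_expConv hl.le hk).congr (EventuallyEq.symm e)
  · rw [Lp.norm_toLp, Lp.norm_def, ← ENNReal.toReal_ofReal (inv_nonneg.2 hβ.le),
      ← ENNReal.toReal_mul]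
    exact ENNReal.toReal_mono hfin.ne hb

/-- The constructed solution with the same right-hand side differs from `ξ` by an element of the
kernel of `l - P`, which is trivial. So the explicit formula and its bound hold on all of `D(P)`. -/
lemma PGraph.ae_eq_expConv {δ : ℝ} (hδ : 0 ≤ δ) (hκ : κ.Decays δ) {l : ℝ} (hl : 0 < l)
    {ξ η : StateSpace A κ} (h : PGraph A κ ξ η) :
    ξ =ᵐ[volume.restrict κ.Ω] expConv κ.Ω l (l • ξ - η : StateSpace A κ) ∧
      ‖ξ‖ ≤ (l + δ / 2)⁻¹ * ‖l • ξ - η‖ := by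
  obtain ⟨ζ, h1, h2, h3⟩ := exists_PGraph_resolvent hδ hκ hl (l • ξ - η)
  have h4 := h.sub h1
  have h5 : η - (l • ζ - (l • ξ - η)) = l • (ξ - ζ) := by rw [smul_sub]; abel
  rw [h5] at h4
  rw [sub_eq_zero.1 (h4.eq_zero_of_smul_self hl.le)] at h2 h3 ⊢
  exact ⟨h2, h3⟩

/-- Dissipativity of `P`. -/
lemma PGraph.inner_le {δ : ℝ} (hδ : 0 ≤ δ) (hκ : κ.Decays δ) {ξ η : StateSpace A κ}
    (h : PGraph A κ ξ η) : ⟪ξ, η⟫ ≤ -(δ / 2) * ‖ξ‖ ^ 2 := by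
  -- Squaring `(l + δ/2) ‖ξ‖ ≤ ‖l ξ - η‖` cancels the `l²` terms. The left side is linear in `l` and
  -- the right side fixed, so its coefficient cannot be positive.
  have h1 : ∀ l : ℝ, 0 < l → 2 * l * (⟪ξ, η⟫ + δ / 2 * ‖ξ‖ ^ 2) ≤ ‖η‖ ^ 2 := by
    intro l hl
    have h2 := (h.ae_eq_expConv hδ hκ hl).2
    have hβ : 0 < l + δ / 2 := by positivity
    rw [inv_mul_eq_div, le_div_iff₀ hβ] at h2
    have h3 := pow_le_pow_left₀ (by positivity) h2 2
    rw [norm_sub_sq_real, norm_smul, real_inner_smul_left, Real.norm_of_nonneg hl.le, mul_pow,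
      mul_pow] at h3
    nlinarith [mul_nonneg (sq_nonneg δ) (sq_nonneg ‖ξ‖)]
  by_contra hcon
  have hpos : 0 < ⟪ξ, η⟫ + δ / 2 * ‖ξ‖ ^ 2 := by linarith
  -- This `l` makes the left side `‖η‖² + 1`.
  have h2 := h1 ((‖η‖ ^ 2 + 1) / (2 * (⟪ξ, η⟫ + δ / 2 * ‖ξ‖ ^ 2))) (by positivity)
  rw [mul_div_assoc', div_mul_eq_mul_div, mul_right_comm,
    mul_div_assoc, mul_comm, div_mul_cancel₀ _ (by positivity)] at h2
  linarith

/-- The embedding `x ↦ μ x` of `V` in the state space. -/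
def mulμ (A : PosOperator H) (κ : Kernel) : A.V →L[ℝ] StateSpace A κ := constLp κ.memLp_one_mul

/-- The total integral `ξ ↦ ∫_Ω ξ`. -/
def total (A : PosOperator H) (κ : Kernel) : StateSpace A κ →L[ℝ] A.V := moment κ.memLp_one_mul

lemma total_apply (ξ : StateSpace A κ) : total A κ ξ = ∫ τ in κ.Ω, ξ τ := by
  exact (moment_apply κ.memLp_one_mul ξ).trans (by simp)

lemma inner_mulμ (ξ : StateSpace A κ) (x : A.V) : ⟪ξ, mulμ A κ x⟫ = ⟪total A κ ξ, x⟫ :=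
  (ContinuousLinearMap.adjoint_inner_left _ _ _).symm

lemma coeFn_mulμ (x : A.V) : mulμ A κ x =ᵐ[volume.restrict κ.Ω] fun s => κ.μ s • x := by
  exact (coeFn_constLp κ.memLp_one_mul x).trans (Eventually.of_forall fun s => by simp)

lemma total_of_ae_eq_expConv {l : ℝ} (hl : 0 < l) {ξ k : StateSpace A κ}
    (h : ξ =ᵐ[volume.restrict κ.Ω] expConv κ.Ω l k) :
    total A κ ξ = moment (κ.memLp_expWeight hl) k := by
  rw [total_apply, moment_apply, integral_congr_ae h,
    integral_expConv hl (κ.integrableOn_coe k)]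
  rfl

end

section

/-! ### The operator `𝔸` -/

variable {H : Type u} [NormedAddCommGroup H] [InnerProductSpace ℝ H] [CompleteSpace H]
  {A : PosOperator H} {κ : Kernel}

namespace ExtState

lemma norm_sq (z : ExtState A κ) : ‖z‖ ^ 2 = ‖z.u‖ ^ 2 + ‖z.v‖ ^ 2 + ‖z.ξ‖ ^ 2 := by
  rw [WithLp.prod_norm_sq_eq_of_L2, WithLp.prod_norm_sq_eq_of_L2, ← add_assoc]
  rfl

lemma inner_eq (z w : ExtState A κ) : ⟪z, w⟫ = ⟪z.u, w.u⟫ + ⟪z.v, w.v⟫ + ⟪z.ξ, w.ξ⟫ := by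
  rw [WithLp.prod_inner_apply, WithLp.prod_inner_apply, ← add_assoc]
  rfl

/-- The element `(u, v, ξ)` of `𝔄`. -/
def mk (u : A.V) (v : H) (ξ : StateSpace A κ) : ExtState A κ :=
  WithLp.toLp 2 (u, WithLp.toLp 2 (v, ξ))

lemma ext' {z w : ExtState A κ} (hu : z.u = w.u) (hv : z.v = w.v) (hξ : z.ξ = w.ξ) : z = w := by
  apply WithLp.ofLp_injective
  apply Prod.ext hu
  apply WithLp.ofLp_injective
  exact Prod.ext hv hξ

variable (A κ)

/-- The first projection as a bounded operator. -/
def uL : ExtState A κ →L[ℝ] A.V := WithLp.fstL 2 ℝ _ _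

/-- The second projection as a bounded operator. -/
def vL : ExtState A κ →L[ℝ] H := (WithLp.fstL 2 ℝ _ _).comp (WithLp.sndL 2 ℝ _ _)

/-- The third projection as a bounded operator. -/
def ξL : ExtState A κ →L[ℝ] StateSpace A κ :=
  (WithLp.sndL 2 ℝ _ _).comp (WithLp.sndL 2 ℝ _ _)

end ExtState

lemma AAGraph_iff {z z' : ExtState A κ} :
    AAGraph A κ z z' ↔ A.incl z'.u = z.v ∧ (A.incl (z.u + total A κ z.ξ), -z'.v) ∈ A.op.graph ∧
      PGraph A κ z.ξ (z'.ξ - mulμ A κ z'.u) := by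
  rw [AAGraph, ← total_apply]
  refine and_congr_right fun _ => and_congr_right fun _ => ⟨?_, fun h => ⟨_, h, ?_⟩⟩
  · rintro ⟨η, hη, h⟩
    have : z'.ξ = η + mulμ A κ z'.u := by
      refine Lp.ext (Kernel.ae_to_νMeasure ?_)
      filter_upwards [h, Kernel.ae_of_νMeasure (Lp.coeFn_add η (mulμ A κ z'.u)),
        coeFn_mulμ (κ := κ) z'.u] with s h1 h2 h3
      rw [h1, h2, Pi.add_apply, h3]
    rwa [this, add_sub_cancel_right]
  · filter_upwards [Kernel.ae_of_νMeasure (Lp.coeFn_sub z'.ξ (mulμ A κ z'.u)),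
      coeFn_mulμ (κ := κ) z'.u] with s h2 h3
    rw [h2, Pi.sub_apply, h3, sub_add_cancel]

/-- The graph of `𝔸` as a subspace. -/
def AASubmodule (A : PosOperator H) (κ : Kernel) : Submodule ℝ (ExtState A κ × ExtState A κ) where
  carrier := {p | AAGraph A κ p.1 p.2}
  zero_mem' := by
    change AAGraph A κ 0 0
    have e0 : (0 : ExtState A κ).u = 0 := rfl
    have e1 : (0 : ExtState A κ).v = 0 := rfl
    have e2 : (0 : ExtState A κ).ξ = 0 := rfl
    rw [AAGraph_iff, e0, e1, e2]
    simp only [map_zero, add_zero, neg_zero, sub_zero, true_and]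
    exact ⟨A.op.graph.zero_mem, PGraph.zero⟩
  add_mem' := by
    rintro ⟨z, z'⟩ ⟨w, w'⟩ h h'
    change AAGraph A κ (z + w) (z' + w')
    change AAGraph A κ z z' at h
    change AAGraph A κ w w' at h'
    rw [AAGraph_iff] at h h' ⊢
    have e0 : ∀ z w : ExtState A κ, (z + w).u = z.u + w.u := fun _ _ => rfl
    have e1 : ∀ z w : ExtState A κ, (z + w).v = z.v + w.v := fun _ _ => rfl
    have e2 : ∀ z w : ExtState A κ, (z + w).ξ = z.ξ + w.ξ := fun _ _ => rfl
    simp only [e0, e1, e2, map_add] at h h' ⊢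
    refine ⟨by rw [h.1, h'.1], ?_, ?_⟩
    · have := A.op.graph.add_mem h.2.1 h'.2.1
      convert! this using 1
      simp only [Prod.mk_add_mk, Prod.mk.injEq]
      exact ⟨by abel, by abel⟩
    · have := h.2.2.add h'.2.2
      convert! this using 1
      abel
  smul_mem' := by
    rintro c ⟨z, z'⟩ h
    change AAGraph A κ (c • z) (c • z')
    change AAGraph A κ z z' at h
    rw [AAGraph_iff] at h ⊢
    have e0 : ∀ z : ExtState A κ, (c • z).u = c • z.u := fun _ => rfl
    have e1 : ∀ z : ExtState A κ, (c • z).v = c • z.v := fun _ => rfl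
    have e2 : ∀ z : ExtState A κ, (c • z).ξ = c • z.ξ := fun _ => rfl
    simp only [e0, e1, e2, map_smul] at h ⊢
    refine ⟨by rw [h.1], ?_, ?_⟩
    · have := A.op.graph.smul_mem c h.2.1
      convert! this using 1
      simp [smul_add]
    · have := h.2.2.const_smul c
      rwa [smul_sub] at this

lemma mem_AASubmodule {z z' : ExtState A κ} : (z, z') ∈ AASubmodule A κ ↔ AAGraph A κ z z' :=
  Iff.rfl

/-- The terms `⟪u, v⟫_V`, `-⟪u + ∫ ξ, v⟫_V` and `⟪ξ, μ v⟫ = ⟪∫ ξ, v⟫_V` sum to zero, leaving only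
`Pξ`. -/
lemma AAGraph.inner_eq {z z' : ExtState A κ} (h : AAGraph A κ z z') :
    ⟪z, z'⟫ = ⟪z.ξ, z'.ξ - mulμ A κ z'.u⟫ := by
  rw [AAGraph_iff] at h
  have h1 := A.inner_of_mem_graph h.2.1 z'.u
  rw [h.1, inner_neg_left, inner_add_left] at h1
  rw [ExtState.inner_eq, inner_sub_right, inner_mulμ, real_inner_comm z'.v]
  linarith

lemma AAGraph.inner_le {δ : ℝ} (hδ : 0 ≤ δ) (hκ : κ.Decays δ) {z z' : ExtState A κ}
    (h : AAGraph A κ z z') : ⟪z, z'⟫ ≤ -(δ / 2) * ‖z.ξ‖ ^ 2 := by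
  rw [h.inner_eq]
  exact (AAGraph_iff.1 h).2.2.inner_le hδ hκ

/-- With `x = v` as unknown in `V`, the first equation gives `u = l⁻¹ (f.u + x)` and the third gives
`∫ ξ = c x + m f.ξ`. Hence `w = u + ∫ ξ = (l⁻¹ + c) x + g`, so `x = a (w - g)`, and the second
equation becomes `A w + l a w = f.v + l a g`. -/
lemma exists_AAGraph_resolvent {δ : ℝ} (hδ : 0 ≤ δ) (hκ : κ.Decays δ) {l : ℝ} (hl : 0 < l)
    (f : ExtState A κ) : ∃ z z', AAGraph A κ z z' ∧ l • z - z' = f := by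
  set m := moment (X := A.V) (κ.memLp_expWeight hl) with hm
  set c := ∫ s in κ.Ω, expWeight l s * (1 * κ.μ s) with hc
  have hcpos : 0 < c := κ.integral_expWeight_mul_pos hl
  set a := (l⁻¹ + c)⁻¹ with ha
  have hapos : 0 < a := by positivity
  set g : A.V := l⁻¹ • f.u + m f.ξ with hg
  obtain ⟨w₀, hw₀⟩ := A.exists_add_smul_eq (a := l * a) (by positivity)
    (f.v + (l * a) • A.incl g)
  obtain ⟨w, rfl⟩ := A.exists_incl_of_mem_graph hw₀
  set x : A.V := a • (w - g) with hx
  obtain ⟨ξ, hξ, hξe, -⟩ := exists_PGraph_resolvent hδ hκ hl (mulμ A κ x + f.ξ)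
  have htot : total A κ ξ = c • x + m f.ξ := by
    rw [total_of_ae_eq_expConv hl hξe, map_add]
    congr 1
    exact moment_constLp _ _ x
  have hw : l⁻¹ • (f.u + x) + total A κ ξ = w := by
    have h1 : (l⁻¹ + c) • x = w - g := by
      rw [hx, ha, smul_inv_smul₀ (by positivity)]
    refine Eq.trans ?_ (eq_add_of_sub_eq h1.symm).symm
    rw [htot, hg]
    module
  refine ⟨ExtState.mk (l⁻¹ • (f.u + x)) (A.incl x) ξ,
    ExtState.mk x (-(f.v - l • A.incl x)) (l • ξ - f.ξ), ?_, ?_⟩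
  · rw [AAGraph_iff]
    refine ⟨rfl, ?_, ?_⟩
    · change (A.incl (l⁻¹ • (f.u + x) + total A κ ξ), -(-(f.v - l • A.incl x))) ∈ A.op.graph
      rw [hw, neg_neg]
      convert! hw₀ using 2
      rw [hx, map_smul, map_sub]
      module
    · change PGraph A κ ξ (l • ξ - f.ξ - mulμ A κ x)
      rwa [sub_sub, add_comm f.ξ]
  · refine ExtState.ext' ?_ ?_ ?_
    · change l • l⁻¹ • (f.u + x) - x = f.u
      rw [smul_inv_smul₀ hl.ne', add_sub_cancel_right]
    · change l • A.incl x - -(f.v - l • A.incl x) = f.v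
      abel
    · change l • ξ - (l • ξ - f.ξ) = f.ξ
      abel

lemma isMDissipative_AASubmodule {δ : ℝ} (hδ : 0 ≤ δ) (hκ : κ.Decays δ) :
    IsMDissipative (AASubmodule A κ) where
  dissipative z z' h := ((mem_AASubmodule.1 h).inner_le hδ hκ).trans (by
    have := mul_nonneg (by positivity : 0 ≤ δ / 2) (sq_nonneg ‖z.ξ‖)
    linarith)
  range l hl f := exists_AAGraph_resolvent hδ hκ hl f
  single z' h := by
    obtain ⟨h1, h2, h3⟩ := AAGraph_iff.1 (mem_AASubmodule.1 h)
    have e0 : (0 : ExtState A κ).u = 0 := rfl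
    have e1 : (0 : ExtState A κ).v = 0 := rfl
    have e2 : (0 : ExtState A κ).ξ = 0 := rfl
    rw [e0, e2] at h2
    rw [e1] at h1
    rw [e2] at h3
    have hu : z'.u = 0 := A.incl_injective (by rw [h1, map_zero])
    refine ExtState.ext' hu ?_ ?_
    · exact neg_eq_zero.1 (A.op.graph_fst_eq_zero_snd h2 (by simp))
    · have := h3.eq_zero_of_zero
      rwa [hu, map_zero, sub_zero] at this

end

section

/-! ### Exponential stability -/

variable {H : Type u} [NormedAddCommGroup H] [InnerProductSpace ℝ H] [CompleteSpace H]

variable (A : PosOperator H) (κ : Kernel)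

/-- The weighted integral `ξ ↦ ∫_Ω (1 - e^{-s}) ξ(s) ds`, with weight vanishing at `0`. -/
def weighted : StateSpace A κ →L[ℝ] A.V := moment (κ.memLp_expWeight one_pos)

variable {A κ}

lemma weighted_mulμ (x : A.V) :
    weighted A κ (mulμ A κ x) = (∫ s in κ.Ω, expWeight 1 s * (1 * κ.μ s)) • x :=
  moment_constLp _ _ x

/-- This is integration by parts against `1 - e^{-s}`, read off from the formula for `∫ ξ` through
the resolvent at `l = 1`. -/
lemma PGraph.weighted_eq {δ : ℝ} (hδ : 0 ≤ δ) (hκ : κ.Decays δ) {ξ η : StateSpace A κ}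
    (h : PGraph A κ ξ η) : weighted A κ η = weighted A κ ξ - total A κ ξ := by
  have h1 := total_of_ae_eq_expConv one_pos (h.ae_eq_expConv hδ hκ one_pos).1
  rw [one_smul] at h1
  rw [h1, map_sub]
  exact (sub_sub_cancel _ _).symm

variable (A κ)

/-- The real inner product as a bounded bilinear form. -/
def innerL (E : Type*) [NormedAddCommGroup E] [InnerProductSpace ℝ E] : E →L[ℝ] E →L[ℝ] ℝ :=
  innerSL ℝ

/-- The Lyapunov functional `(N/2) ‖z‖² - ⟪v, ∫ (1 - e^{-s}) ξ⟫ + ε ⟪v, u⟫`, as a bilinear form. -/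
def lyapunov (N ε : ℝ) : ExtState A κ →L[ℝ] ExtState A κ →L[ℝ] ℝ :=
  (N / 2) • innerL (ExtState A κ) -
    (innerL H).bilinearComp (ExtState.vL A κ)
      (A.inclL.comp ((weighted A κ).comp (ExtState.ξL A κ))) +
    ε • (innerL H).bilinearComp (ExtState.vL A κ) (A.inclL.comp (ExtState.uL A κ))

variable {A κ}

lemma lyapunov_apply (N ε : ℝ) (z w : ExtState A κ) :
    lyapunov A κ N ε z w = N / 2 * ⟪z, w⟫ - ⟪z.v, A.incl (weighted A κ w.ξ)⟫ +
      ε * ⟪z.v, A.incl w.u⟫ := rfl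

/-- The terms with `A` become inner products in `V`, since `W ξ` and `u` lie in `V`. The damping `-c
‖v‖²` comes from the `μ v` part of the third component. -/
lemma AAGraph.lyapunov_eq {δ : ℝ} (hδ : 0 ≤ δ) (hκ : κ.Decays δ) (N ε : ℝ) {z z' : ExtState A κ}
    (h : AAGraph A κ z z') :
    lyapunov A κ N ε z z' + lyapunov A κ N ε z' z = N * ⟪z, z'⟫
      - ⟪z.v, A.incl (weighted A κ z.ξ - total A κ z.ξ)⟫
      - (∫ s in κ.Ω, expWeight 1 s * (1 * κ.μ s)) * ‖z.v‖ ^ 2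
      + ⟪z.u + total A κ z.ξ, weighted A κ z.ξ⟫
      + ε * (‖z.v‖ ^ 2 - ⟪z.u + total A κ z.ξ, z.u⟫) := by
  obtain ⟨h1, h2, h3⟩ := AAGraph_iff.1 h
  have e1 := A.inner_of_mem_graph h2 (weighted A κ z.ξ)
  have e2 := A.inner_of_mem_graph h2 z.u
  rw [inner_neg_left] at e1 e2
  have e3 : weighted A κ z'.ξ = weighted A κ z.ξ - total A κ z.ξ +
      (∫ s in κ.Ω, expWeight 1 s * (1 * κ.μ s)) • z'.u := by
    rw [← h3.weighted_eq hδ hκ, ← weighted_mulμ, ← map_add, sub_add_cancel]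
  rw [lyapunov_apply, lyapunov_apply, e3, map_add, map_smul, inner_add_right,
    real_inner_smul_right, h1, real_inner_self_eq_norm_sq, real_inner_comm z z']
  linear_combination e1 - ε * e2

/-- The algebra behind the Lyapunov estimate. -/
lemma lyapunov_algebra {c C N δ p q n : ℝ} (hc : 0 < c)
    (hN : c / 4 + C ^ 2 + C ^ 2 / c + C ^ 2 * (1 + c / 2) ^ 2 / c ≤ N * (δ / 2)) :
    -(N * (δ / 2)) * n ^ 2 + C * q * n - c * q ^ 2 + (p + C * n) * (C * n)
      + c / 2 * (q ^ 2 - p ^ 2 + C * n * p) ≤ -(c / 4) * (p ^ 2 + q ^ 2 + n ^ 2) := by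
  -- Here `p, q, n` stand for the norms of `u, v, ξ`. Two Young inequalities use up `c/4` of the
  -- available `c/2` in `q²` and in `p²`. The four terms of `hN` pay for `n²`: the target `c/4`, the
  -- product `(C n)²`, and the two Young remainders.
  have h1 : C * q * n ≤ c / 4 * q ^ 2 + C ^ 2 / c * n ^ 2 := by
    have : 0 ≤ c * (q / 2 - C * n / c) ^ 2 := by positivity
    have e : c * (q / 2 - C * n / c) ^ 2 = c / 4 * q ^ 2 + C ^ 2 / c * n ^ 2 - C * q * n := by
      field_simp; ring
    linarith
  have h2 : C * (1 + c / 2) * p * n ≤ c / 4 * p ^ 2 + C ^ 2 * (1 + c / 2) ^ 2 / c * n ^ 2 := by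
    have : 0 ≤ c * (p / 2 - C * (1 + c / 2) * n / c) ^ 2 := by positivity
    have e : c * (p / 2 - C * (1 + c / 2) * n / c) ^ 2 = c / 4 * p ^ 2 +
        C ^ 2 * (1 + c / 2) ^ 2 / c * n ^ 2 - C * (1 + c / 2) * p * n := by
      field_simp; ring
    linarith
  have h3 := mul_le_mul_of_nonneg_right hN (sq_nonneg n)
  nlinarith

variable (A κ) in
lemma exists_norm_moment_le : ∃ C : ℝ, 0 ≤ C ∧ (∀ ξ, ‖total A κ ξ‖ ≤ C * ‖ξ‖) ∧
    (∀ ξ, ‖weighted A κ ξ‖ ≤ C * ‖ξ‖) ∧ (∀ u, ‖A.incl u‖ ≤ C * ‖u‖) ∧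
    (∀ ξ, ‖A.incl (weighted A κ ξ)‖ ≤ C * ‖ξ‖) ∧
    (∀ ξ, ‖A.incl (weighted A κ ξ - total A κ ξ)‖ ≤ C * ‖ξ‖) := by
  let T1 := A.inclL.comp (weighted A κ)
  let T2 := A.inclL.comp (weighted A κ - total A κ)
  refine ⟨‖total A κ‖ + ‖weighted A κ‖ + ‖A.inclL‖ + ‖T1‖ + ‖T2‖, by positivity,
    fun ξ => ((total A κ).le_opNorm ξ).trans ?_, fun ξ => ((weighted A κ).le_opNorm ξ).trans ?_,
    fun u => (A.inclL.le_opNorm u).trans ?_, fun ξ => (T1.le_opNorm ξ).trans ?_,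
    fun ξ => (T2.le_opNorm ξ).trans ?_⟩
  all_goals
    refine mul_le_mul_of_nonneg_right ?_ (norm_nonneg _)
    linarith [norm_nonneg (total A κ), norm_nonneg (weighted A κ), norm_nonneg A.inclL,
      norm_nonneg T1, norm_nonneg T2]

/-- The Lyapunov functional is equivalent to the energy. -/
lemma abs_lyapunov_sub_le {C : ℝ} (hC : 0 ≤ C) (hCi : ∀ u, ‖A.incl u‖ ≤ C * ‖u‖)
    (hCiw : ∀ ξ, ‖A.incl (weighted A κ ξ)‖ ≤ C * ‖ξ‖) (N : ℝ) {ε : ℝ} (hε : 0 ≤ ε)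
    (z : ExtState A κ) :
    |lyapunov A κ N ε z z - N / 2 * ‖z‖ ^ 2| ≤ C * (1 + ε) * ‖z‖ ^ 2 := by
  have h0 := z.norm_sq
  have h1 := abs_real_inner_le_norm z.v (A.incl (weighted A κ z.ξ))
  have h2 := abs_real_inner_le_norm z.v (A.incl z.u)
  have h3 := mul_le_mul_of_nonneg_left (hCiw z.ξ) (norm_nonneg z.v)
  have h4 := mul_le_mul_of_nonneg_left (hCi z.u) (norm_nonneg z.v)
  have h5 : ‖z.v‖ * (C * ‖z.ξ‖) ≤ C * ‖z‖ ^ 2 := by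
    have : ‖z.v‖ * ‖z.ξ‖ ≤ ‖z‖ ^ 2 := by
      linarith [sq_nonneg (‖z.v‖ - ‖z.ξ‖), sq_nonneg ‖z.u‖, sq_nonneg ‖z.v‖, sq_nonneg ‖z.ξ‖,
        two_mul_le_add_sq ‖z.v‖ ‖z.ξ‖]
    have := mul_le_mul_of_nonneg_left this hC
    linarith
  have h6 : ‖z.v‖ * (C * ‖z.u‖) ≤ C * ‖z‖ ^ 2 := by
    have : ‖z.v‖ * ‖z.u‖ ≤ ‖z‖ ^ 2 := by
      linarith [sq_nonneg (‖z.v‖ - ‖z.u‖), sq_nonneg ‖z.u‖, sq_nonneg ‖z.v‖, sq_nonneg ‖z.ξ‖,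
        two_mul_le_add_sq ‖z.v‖ ‖z.u‖]
    have := mul_le_mul_of_nonneg_left this hC
    linarith
  have e : lyapunov A κ N ε z z - N / 2 * ‖z‖ ^ 2 =
      ε * ⟪z.v, A.incl z.u⟫ - ⟪z.v, A.incl (weighted A κ z.ξ)⟫ := by
    rw [lyapunov_apply, real_inner_self_eq_norm_sq]; ring
  rw [e]
  refine (abs_sub _ _).trans ?_
  rw [abs_mul, abs_of_nonneg hε]
  have h7 := mul_le_mul_of_nonneg_left (h2.trans (h4.trans h6)) hε
  have h8 := h1.trans (h3.trans h5)
  linarith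

/-- Decay of the Lyapunov functional. -/
lemma AAGraph.lyapunov_le {δ : ℝ} (hδ : 0 ≤ δ) (hκ : κ.Decays δ) {c C N : ℝ}
    (hc : c = ∫ s in κ.Ω, expWeight 1 s * (1 * κ.μ s)) (hc0 : 0 < c) (hC : 0 ≤ C) (hN0 : 0 ≤ N)
    (hCt : ∀ ξ, ‖total A κ ξ‖ ≤ C * ‖ξ‖) (hCw : ∀ ξ, ‖weighted A κ ξ‖ ≤ C * ‖ξ‖)
    (hCd : ∀ ξ, ‖A.incl (weighted A κ ξ - total A κ ξ)‖ ≤ C * ‖ξ‖)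
    (hN : c / 4 + C ^ 2 + C ^ 2 / c + C ^ 2 * (1 + c / 2) ^ 2 / c ≤ N * (δ / 2))
    {z z' : ExtState A κ} (h : AAGraph A κ z z') :
    lyapunov A κ N (c / 2) z z' + lyapunov A κ N (c / 2) z' z ≤ -(c / 4) * ‖z‖ ^ 2 := by
  rw [h.lyapunov_eq hδ hκ, ← hc]
  have h1 := mul_le_mul_of_nonneg_left (h.inner_le hδ hκ) hN0
  have h2 := (neg_le_abs _).trans
    (abs_real_inner_le_norm z.v (A.incl (weighted A κ z.ξ - total A κ z.ξ)))
  have h3 := mul_le_mul_of_nonneg_left (hCd z.ξ) (norm_nonneg z.v)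
  have h4 := real_inner_le_norm (z.u + total A κ z.ξ) (weighted A κ z.ξ)
  have h5 : ‖z.u + total A κ z.ξ‖ ≤ ‖z.u‖ + C * ‖z.ξ‖ :=
    (norm_add_le _ _).trans (add_le_add le_rfl (hCt _))
  have h6 : ‖z.u + total A κ z.ξ‖ * ‖weighted A κ z.ξ‖ ≤
      (‖z.u‖ + C * ‖z.ξ‖) * (C * ‖z.ξ‖) :=
    mul_le_mul h5 (hCw _) (norm_nonneg _) (by positivity)
  have h7 : -⟪z.u + total A κ z.ξ, z.u⟫ ≤ -‖z.u‖ ^ 2 + C * ‖z.ξ‖ * ‖z.u‖ := by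
    rw [inner_add_left, real_inner_self_eq_norm_sq]
    have := (neg_le_abs _).trans (abs_real_inner_le_norm (total A κ z.ξ) z.u)
    have := mul_le_mul_of_nonneg_right (hCt z.ξ) (norm_nonneg z.u)
    linarith
  have h8 := mul_le_mul_of_nonneg_left h7 (by positivity : 0 ≤ c / 2)
  have h9 := lyapunov_algebra (p := ‖z.u‖) (q := ‖z.v‖) (n := ‖z.ξ‖) hc0 hN
  rw [← z.norm_sq] at h9
  linarith

/-- The growth bound for the semigroup generated by `𝔸`. -/
theorem exists_exponential_bound {δ : ℝ} (hδ : 0 < δ) (hκ : κ.Decays δ) :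
    ∃ K : ℝ, 1 < K ∧ ∃ ω : ℝ, 0 < ω ∧ ∀ S : ℝ≥0 → ExtState A κ →L[ℝ] ExtState A κ,
      IsGeneratedBy S (AAGraph A κ) → ∀ (t : ℝ≥0) (z : ExtState A κ),
        ‖S t z‖ ≤ K * ‖z‖ * Real.exp (-ω * t) := by
  obtain ⟨c, hc⟩ : ∃ c, c = ∫ s in κ.Ω, expWeight 1 s * (1 * κ.μ s) := ⟨_, rfl⟩
  have hc0 : 0 < c := hc ▸ κ.integral_expWeight_mul_pos one_pos
  obtain ⟨C, hC, hCt, hCw, hCi, hCiw, hCd⟩ := exists_norm_moment_le A κ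
  obtain ⟨D, hD⟩ : ∃ D, D = c / 4 + C ^ 2 + C ^ 2 / c + C ^ 2 * (1 + c / 2) ^ 2 / c := ⟨_, rfl⟩
  have hD0 : 0 ≤ D := by rw [hD]; positivity
  obtain ⟨B, hB⟩ : ∃ B, B = C * (1 + c / 2) := ⟨_, rfl⟩
  have hB0 : 0 ≤ B := by rw [hB]; positivity
  -- The first summand gives `N δ/2 ≥ D`, which absorbs the errors in `ξ`; the second gives `N/2 ≥ B
  -- + 1`, so the functional dominates `‖z‖²`.
  obtain ⟨N, hN⟩ : ∃ N, N = D * (2 / δ) + 2 * (B + 1) := ⟨_, rfl⟩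
  have hN1 : D ≤ N * (δ / 2) := by
    have h1 : D * (2 / δ) * (δ / 2) = D := by field_simp
    have h2 : 0 ≤ 2 * (B + 1) * (δ / 2) := by positivity
    rw [hN, add_mul, h1]; linarith
  have hN2 : B + 1 ≤ N / 2 := by
    have : 0 ≤ D * (2 / δ) := by positivity
    linarith
  have hcross : ∀ z : ExtState A κ,
      |lyapunov A κ N (c / 2) z z - N / 2 * ‖z‖ ^ 2| ≤ B * ‖z‖ ^ 2 :=
    hB ▸ abs_lyapunov_sub_le hC hCi hCiw N (half_pos hc0).le
  obtain ⟨M, hM⟩ : ∃ M, M = N / 2 + B := ⟨_, rfl⟩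
  have hM0 : 0 < M := by linarith
  have hupper : ∀ z, lyapunov A κ N (c / 2) z z ≤ M * ‖z‖ ^ 2 := fun z => by
    have := (le_abs_self _).trans (hcross z)
    rw [hM]; linarith
  have hlower : ∀ z, 1 * ‖z‖ ^ 2 ≤ lyapunov A κ N (c / 2) z z := fun z => by
    have h1 := (neg_le_abs _).trans (hcross z)
    have h2 := mul_le_mul_of_nonneg_right hN2 (sq_nonneg ‖z‖)
    linarith
  have hω : ∀ z z', AAGraph A κ z z' →
      lyapunov A κ N (c / 2) z z' + lyapunov A κ N (c / 2) z' z ≤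
        -2 * (c / (8 * M)) * lyapunov A κ N (c / 2) z z := by
    intro z z' h
    have h1 := h.lyapunov_le hδ.le hκ hc hc0 hC (by linarith) hCt hCw hCd (hD ▸ hN1)
    have h2 := mul_le_mul_of_nonneg_left (hupper z) (by positivity : 0 ≤ 2 * (c / (8 * M)))
    have e : 2 * (c / (8 * M)) * (M * ‖z‖ ^ 2) = c / 4 * ‖z‖ ^ 2 := by
      field_simp; ring
    linarith
  -- Adding `1` ensures `K > 1`. The rate solves `2 ω M = c / 4`, so a decay of `(c/4) ‖z‖²`
  -- controls the functional itself.
  refine ⟨√(M / 1) + 1, by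
    have : 0 < √(M / 1) := Real.sqrt_pos.2 (by positivity)
    linarith, c / (8 * M), by positivity, fun S hS t z => ?_⟩
  have hmd : IsMDissipative (AASubmodule A κ) := isMDissipative_AASubmodule hδ.le hκ
  refine (hS.norm_le_of_lyapunov (lyapunov A κ N (c / 2)) one_pos hlower hupper hω
    (fun z ε hε => hmd.dense_domain z hε) t z).trans ?_
  gcongr
  linarith

end

end MemoryState

end

theorem theorem9p1 {H : Type*} [NormedAddCommGroup H] [InnerProductSpace ℝ H] [CompleteSpace H]
    [TopologicalSpace.SeparableSpace H] (A : MemoryState.PosOperator H) (κ : MemoryState.Kernel)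
    (δ : ℝ) (hδ : 0 < δ)
    (hμ : ∀ᵐ s ∂volume.restrict κ.Ω, deriv κ.μ s + δ * κ.μ s ≤ 0) :
    (∃ S : ℝ≥0 → MemoryState.ExtState A κ →L[ℝ] MemoryState.ExtState A κ,
      MemoryState.IsGeneratedBy S (MemoryState.AAGraph A κ)) ∧
    ∃ K : ℝ, 1 < K ∧ ∃ ω : ℝ, 0 < ω ∧
      ∀ S : ℝ≥0 → MemoryState.ExtState A κ →L[ℝ] MemoryState.ExtState A κ,
        MemoryState.IsGeneratedBy S (MemoryState.AAGraph A κ) →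
        ∀ (t : ℝ≥0) (z : MemoryState.ExtState A κ),
          ‖S t z‖ ≤ K * ‖z‖ * Real.exp (-ω * t) := by
  have hκ : κ.Decays δ := fun s hs t ht hst => κ.exp_mul_ν_le hμ hs ht hst
  exact ⟨(MemoryState.isMDissipative_AASubmodule (A := A) hδ.le hκ).exists_semigroup,
    MemoryState.exists_exponential_bound hδ hκ⟩
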